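/- Let $n\ge 0$ be an integer, let $B$ be a real $n\times n$ matrix and let $Q$ be a real symmetric positive semidefinite $n\times n$ matrix. Assume the Kalman rank condition $\operatorname{Rank}[Q,BQ,\dots,B^{n-1}Q]=n$, and assume that the smallest integer $0\le r\le n-1$ with $$\operatorname{Ker}(Q)\cap\operatorname{Ker}(QB^T)\cap\dots\cap\operatorname{Ker}(Q(B^T)^r)=\{0\}$$ satisfies $r\ge 1$. Let $\lambda_0>0$ and let $q_0,\dots,q_{r-1}$, $s_0,\dots,s_{r-1}$ be real numbers such that $0\le q_{r-1}\le 1$, $s_{r-1}\ge 0$; if $r\ge2$, also $0\le q_{r-2}\le q_{r-1}$ and $0\le s_{r-2}\le s_{r-1}$; and $q_j=s_j=0$ for $0\le j\le r-3$. Let $\lambda_1,\dots,\lambda_r$ be the positive real numbers defined recursively by $$\lambda_{j+1}\Big(\frac{1-q_j}{\lambda_j}+1\Big)=1+s_j,\qquad 0\le j\le r-1.$$ Assume that $\lambda_0>\lambda_1>\dots>\lambda_r$ and, when $r\ge2$, that $$\frac{\lambda_{j-1}}{\lambda_{j-2}}+\frac{\lambda_{j-1}}{\lambda_j}\le2,\qquad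 2\le j\le r.$$ Let $L$ be either the operator $L=\partial_t+Bx\cdot\nabla_x$ on $\mathbb R^{n+1}_{t,x}$ or the operator $L=Bx\cdot\nabla_x$ on $\mathbb R^n_x$, where $Bx\cdot\nabla_x=\sum_{i,j}B_{i,j}x_j\partial_{x_i}$. Accordingly let $\mathscr S$ be the space of complex-valued Schwartz functions and $\|\cdot\|_{L^2}$ the $L^2$ norm on $\mathbb R^{n+1}_{t,x}$, respectively on $\mathbb R^n_x$. Write $\langle\xi\rangle=\sqrt{1+|\xi|^2}$, let $F(D_x)$ be the Fourier multiplier in the variable $x$ with symbol $F(\xi)$, where $D_x=i^{-1}\nabla_x$, and put $\|u\|_{H^s}=\|\langle D_x\rangle^su\|_{L^2}$ (in both cases, so only regularity in $x$ is measured). Then, for each of the two choices of $L$, there exists a constant $c>0$ such that for all $u\in\mathscr S$, $$\|u\|_{H^{\lambda_r}}\le c\Big(\big\|\langle QD_x\rangle^{\lambda_0}u\big\|_{L^2}+\sum_{j=0}^{r-1}\big\|\langle Q(B^T)^jD_x\rangle^{q_j}Lu\big\|_{H^{s_j}}\Big).$$ -/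

import Mathlib

open scoped Matrix SchwartzMap

noncomputable section

namespace Hypoelliptic

/-- The block matrix `[Q, BQ, …, B^{n-1}Q]`; its columns are indexed by pairs
(exponent of `B`, column of `B ^ k * Q`). -/
def kalmanMatrix {n : ℕ} (B Q : Matrix (Fin n) (Fin n) ℝ) :
    Matrix (Fin n) (Fin n × Fin n) ℝ :=
  Matrix.of fun i kj => (B ^ (kj.1 : ℕ) * Q) i kj.2

/-- The Kalman rank condition. -/
def KalmanRankCondition {n : ℕ} (B Q : Matrix (Fin n) (Fin n) ℝ) : Prop :=
  (kalmanMatrix B Q).rank = n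

/-- `r` is the smallest integer `0 ≤ r ≤ n - 1` such that
`Ker Q ∩ Ker (Q Bᵀ) ∩ … ∩ Ker (Q (Bᵀ)^r) = {0}`. -/
def IsKalmanIndex {n : ℕ} (B Q : Matrix (Fin n) (Fin n) ℝ) (r : ℕ) : Prop :=
  IsLeast {k : ℕ | k < n ∧
    ∀ ξ : Fin n → ℝ, (∀ j ≤ k, (Q * Bᵀ ^ j) *ᵥ ξ = 0) → ξ = 0} r

/-- The Japanese bracket `⟨x⟩ = √(1 + |x|²)`. -/
def bracket {E : Type*} [NormedAddCommGroup E] (x : E) : ℝ := √(1 + ‖x‖ ^ 2)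

/-- The symbol `⟨A ξ⟩ ^ σ` on `ℝⁿ`. -/
def bracketSymbol {n : ℕ} (A : Matrix (Fin n) (Fin n) ℝ) (σ : ℝ)
    (ξ : EuclideanSpace ℝ (Fin n)) : ℝ :=
  bracket (WithLp.toLp 2 (A *ᵥ ξ.ofLp) : EuclideanSpace ℝ (Fin n)) ^ σ

/-- The projection `(t, x) ↦ x` of `ℝ^{n+1}` onto `ℝⁿ`; the coordinate of index `0` is `t`. -/
def spacePart (n : ℕ) : EuclideanSpace ℝ (Fin (n + 1)) →L[ℝ] EuclideanSpace ℝ (Fin n) :=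
  LinearMap.toContinuousLinearMap
    { toFun := fun z => WithLp.toLp 2 fun i => z i.succ
      map_add' := fun _ _ => rfl
      map_smul' := fun _ _ => rfl }

/-- The Fourier multiplier `F(D_x)`, `D_x = i⁻¹ ∇_x`, on Schwartz functions on `ℝᵐ`, where
`p : ℝᵐ → ℝⁿ` selects the frequencies dual to `x`: `p` is the identity when the functions depend
on `x` only, and `spacePart n` when they depend on `(t, x)`. The Fourier transform is
`∫ exp(-2πi z·ζ) u(z) dz`, so `D_x` has the symbol `2π ξ`. -/
def multiplierDx {m n : ℕ} (p : EuclideanSpace ℝ (Fin m) →L[ℝ] EuclideanSpace ℝ (Fin n))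
    (F : EuclideanSpace ℝ (Fin n) → ℝ) :
    𝓢(EuclideanSpace ℝ (Fin m), ℂ) →L[ℂ] 𝓢(EuclideanSpace ℝ (Fin m), ℂ) :=
  SchwartzMap.fourierMultiplierCLM ℂ fun ζ => ((F ((2 * Real.pi) • p ζ) : ℝ) : ℂ)

/-- The norm of `L²(ℝᵐ)`. -/
def normL2 {m : ℕ} (u : 𝓢(EuclideanSpace ℝ (Fin m), ℂ)) : ℝ := ‖u.toLp 2‖

/-- The Sobolev norm `‖u‖_{H^s} = ‖⟨D_x⟩^s u‖_{L²}` of order `s` in the variable `x`. -/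
def normHs {m n : ℕ} (p : EuclideanSpace ℝ (Fin m) →L[ℝ] EuclideanSpace ℝ (Fin n)) (s : ℝ)
    (u : 𝓢(EuclideanSpace ℝ (Fin m), ℂ)) : ℝ :=
  normL2 (multiplierDx p (fun ξ => bracket ξ ^ s) u)

/-- The autonomous transport operator `Bx·∇_x = ∑ᵢⱼ Bᵢⱼ xⱼ ∂_{xᵢ}` on `ℝⁿ`. -/
def transport {n : ℕ} (B : Matrix (Fin n) (Fin n) ℝ)
    (u : 𝓢(EuclideanSpace ℝ (Fin n), ℂ)) : 𝓢(EuclideanSpace ℝ (Fin n), ℂ) :=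
  ∑ i, ∑ j, B i j • SchwartzMap.smulLeftCLM ℂ (fun x : EuclideanSpace ℝ (Fin n) => x j)
    (LineDeriv.lineDerivOp (EuclideanSpace.single i (1 : ℝ)) u)

/-- The time-dependent transport operator `∂_t + Bx·∇_x` on `ℝ^{n+1}`. -/
def timeTransport {n : ℕ} (B : Matrix (Fin n) (Fin n) ℝ)
    (u : 𝓢(EuclideanSpace ℝ (Fin (n + 1)), ℂ)) : 𝓢(EuclideanSpace ℝ (Fin (n + 1)), ℂ) :=
  LineDeriv.lineDerivOp (EuclideanSpace.single (0 : Fin (n + 1)) (1 : ℝ)) u +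
  ∑ i : Fin n, ∑ j : Fin n, B i j •
    SchwartzMap.smulLeftCLM ℂ (fun z : EuclideanSpace ℝ (Fin (n + 1)) => z j.succ)
      (LineDeriv.lineDerivOp (EuclideanSpace.single i.succ (1 : ℝ)) u)

/-! The following facts show that the operators above are the intended ones: the multiplication
operators and Fourier multipliers of Mathlib are the zero operator unless the symbol has temperate
growth. -/

theorem coord_hasTemperateGrowth {m : ℕ} (j : Fin m) :
    (fun x : EuclideanSpace ℝ (Fin m) => x j).HasTemperateGrowth :=
  (EuclideanSpace.proj j : EuclideanSpace ℝ (Fin m) →L[ℝ] ℝ).hasTemperateGrowth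

theorem transport_apply {n : ℕ} (B : Matrix (Fin n) (Fin n) ℝ)
    (u : 𝓢(EuclideanSpace ℝ (Fin n), ℂ)) (x : EuclideanSpace ℝ (Fin n)) :
    transport B u x =
      ∑ i, ∑ j, (B i j * x j) • fderiv ℝ u x (EuclideanSpace.single i 1) := by
  simp [transport, sum_apply, SchwartzMap.smulLeftCLM_apply_apply,
    coord_hasTemperateGrowth, SchwartzMap.lineDerivOp_apply_eq_fderiv, mul_assoc]

theorem timeTransport_apply {n : ℕ} (B : Matrix (Fin n) (Fin n) ℝ)
    (u : 𝓢(EuclideanSpace ℝ (Fin (n + 1)), ℂ)) (z : EuclideanSpace ℝ (Fin (n + 1))) :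
    timeTransport B u z = fderiv ℝ u z (EuclideanSpace.single 0 1) +
      ∑ i : Fin n, ∑ j : Fin n,
        (B i j * z j.succ) • fderiv ℝ u z (EuclideanSpace.single i.succ 1) := by
  simp [timeTransport, sum_apply, SchwartzMap.smulLeftCLM_apply_apply,
    coord_hasTemperateGrowth, SchwartzMap.lineDerivOp_apply_eq_fderiv, mul_assoc]

theorem bracket_rpow_hasTemperateGrowth {E : Type*} [NormedAddCommGroup E]
    [InnerProductSpace ℝ E] (s : ℝ) :
    (fun ξ : E => bracket ξ ^ s).HasTemperateGrowth := by
  have h : (fun ξ : E => bracket ξ ^ s) = fun ξ : E => (1 + ‖ξ‖ ^ 2) ^ (s / 2) := by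
    funext ξ
    rw [bracket, Real.sqrt_eq_rpow, ← Real.rpow_mul (by positivity)]
    congr 1
    ring
  rw [h]
  exact Function.hasTemperateGrowth_one_add_norm_sq_rpow E (s / 2)

theorem bracketSymbol_hasTemperateGrowth {n : ℕ} (A : Matrix (Fin n) (Fin n) ℝ) (σ : ℝ) :
    (bracketSymbol A σ).HasTemperateGrowth :=
  (bracket_rpow_hasTemperateGrowth σ).comp
    (Matrix.toEuclideanCLM (𝕜 := ℝ) A).hasTemperateGrowth

theorem fourier_multiplierDx_apply {m n : ℕ}
    (p : EuclideanSpace ℝ (Fin m) →L[ℝ] EuclideanSpace ℝ (Fin n))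
    {F : EuclideanSpace ℝ (Fin n) → ℝ} (hF : F.HasTemperateGrowth)
    (u : 𝓢(EuclideanSpace ℝ (Fin m), ℂ)) (ζ : EuclideanSpace ℝ (Fin m)) :
    FourierTransform.fourier (multiplierDx p F u) ζ =
      ((F ((2 * Real.pi) • p ζ) : ℝ) : ℂ) * FourierTransform.fourier u ζ := by
  have h : (fun ζ => ((F ((2 * Real.pi) • p ζ) : ℝ) : ℂ)).HasTemperateGrowth :=
    Function.Complex.hasTemperateGrowth_ofReal.comp (hF.comp ((2 * Real.pi) • p).hasTemperateGrowth)
  rw [multiplierDx, SchwartzMap.fourierMultiplierCLM_apply, FourierTransform.fourier_fourierInv_eq,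
    SchwartzMap.smulLeftCLM_apply_apply h, smul_eq_mul]

end Hypoelliptic

end

open Hypoelliptic

/-!
On the Fourier side, `L u` becomes `iθ f - A·∇f - b f` with `f = 𝓕 u`, `θ` real, and `A` the linear
vector field which acts on the frequencies `η` dual to `x` as `Bᵀ`. Hence the vectors
`Z k η = Q (Bᵀ) ^ k η` form a chain: the derivative of `Z k` along `A` is `Z (k + 1)`. By the Kalman
condition the levels `k ≤ r` of this chain together control `η`. The level `0` is controlled by the
norm of `⟨Q D_x⟩ ^ λ₀ u`, and the estimate is carried from level to level by weighted energy
identities.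

Fix the target weight `⟨η⟩ ^ λ_r` and measure level `k` in the unit `⟨η⟩ ^ μ k`, `μ k = λ_r / λ_k`,
which is the threshold where `⟨Z k η⟩ ^ λ_k` reaches the target. Let `y k` be the rescaled vectors
(`scaled`), `D j = 1 + ∑_{j ≤ k ≤ r} ‖y k‖²` (`tailEnergy`) and `x j = ‖y j‖² / D j`
(`energyFraction`). The derivative along `A` of the real weight
`g j = ⟨η⟩ ^ (2λ_r + μ j - μ (j + 1)) ⟪y j, y (j + 1)⟫ / D j` (`chainWeight`) is bounded below by
`⟨η⟩ ^ (2λ_r) (x (j + 1) - C √(x j))` (`exists_hasDerivAt_chainWeight`). The assumption on the ratios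
of the `λ`s says that `μ` is concave, so that the levels above `j` evolve no faster than level `j`,
and this is what bounds the errors. The recursion for the `λ`s gives
`|g j| ≤ ⟨η⟩ ^ λ_r ⟨η⟩ ^ s_j ⟨Z j η⟩ ^ q_j` (`abs_chainWeight_le_sourceWeight`), so that the pairing
of `g j f` with `𝓕 (L u)` is controlled by the source norms.

Integrating the divergence of `g j ‖f‖² A` therefore bounds the integral of
`⟨η⟩ ^ (2λ_r) x (j + 1) ‖f‖²` by that of `⟨η⟩ ^ (2λ_r) x j ‖f‖²` and the source term, up to an
arbitrarily small multiple of the square of the left-hand side of the theorem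
(`exists_integral_energyFraction_succ_le`). Induction on `j` bounds all these integrals, and
`∑ x j` is bounded below for `‖η‖ ≥ 1` (`exists_bracket_rpow_le_sum_energyFraction`), which closes the
estimate. The time variable only contributes to `θ`, so both operators are treated at once
(`exists_normHs_le`).
-/

noncomputable section

namespace Hypoelliptic

section

open Finset

variable {E F : Type*} [NormedAddCommGroup E] [InnerProductSpace ℝ E]
  [NormedAddCommGroup F] [InnerProductSpace ℝ F]

/-! ### The rescaled chain and its weights -/

/-- The rescaled vector `⟨η⟩ ^ (-μ k) • Z k η`: the size of `Z k η` measured in the unit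
`⟨η⟩ ^ μ k`. -/
def scaled (μ : ℕ → ℝ) (Z : ℕ → E →L[ℝ] F) (k : ℕ) (η : E) : F :=
  bracket η ^ (-μ k) • Z k η

/-- The energy `1 + ∑ ‖scaled k‖²` of the levels `j ≤ k ≤ r`. -/
def tailEnergy (μ : ℕ → ℝ) (Z : ℕ → E →L[ℝ] F) (r j : ℕ) (η : E) : ℝ :=
  1 + ∑ k ∈ Icc j r, ‖scaled μ Z k η‖ ^ 2

/-- The fraction of the energy `tailEnergy μ Z r j` carried by its lowest level `j`. -/
def energyFraction (μ : ℕ → ℝ) (Z : ℕ → E →L[ℝ] F) (r j : ℕ) (η : E) : ℝ :=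
  ‖scaled μ Z j η‖ ^ 2 / tailEnergy μ Z r j η

/-- The weight whose derivative along the linear flow detects the level `j + 1`. The exponent
`μ j - μ (j + 1)` is that of the time which level `j + 1` needs to move level `j` by one unit. -/
def chainWeight (μ : ℕ → ℝ) (Z : ℕ → E →L[ℝ] F) (r : ℕ) (κ : ℝ) (j : ℕ) (η : E) : ℝ :=
  bracket η ^ (κ + μ j - μ (j + 1)) *
    inner ℝ (scaled μ Z j η) (scaled μ Z (j + 1) η) / tailEnergy μ Z r j η

theorem one_le_bracket {G : Type*} [NormedAddCommGroup G] (x : G) : 1 ≤ bracket x := by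
  rw [bracket, Real.one_le_sqrt]
  nlinarith [sq_nonneg ‖x‖]

theorem bracket_pos {G : Type*} [NormedAddCommGroup G] (x : G) : 0 < bracket x :=
  zero_lt_one.trans_le (one_le_bracket x)

theorem bracket_sq {G : Type*} [NormedAddCommGroup G] (x : G) :
    bracket x ^ 2 = 1 + ‖x‖ ^ 2 :=
  Real.sq_sqrt (by positivity)

theorem norm_le_bracket {G : Type*} [NormedAddCommGroup G] (x : G) : ‖x‖ ≤ bracket x :=
  Real.le_sqrt_of_sq_le (by linarith)

section pointwise

variable {μ : ℕ → ℝ} {Z : ℕ → E →L[ℝ] F} {r : ℕ}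

theorem one_le_tailEnergy (j : ℕ) (η : E) : 1 ≤ tailEnergy μ Z r j η :=
  le_add_of_nonneg_right (sum_nonneg fun _ _ => by positivity)

theorem tailEnergy_pos (j : ℕ) (η : E) : 0 < tailEnergy μ Z r j η :=
  zero_lt_one.trans_le (one_le_tailEnergy j η)

theorem sq_norm_scaled_le_tailEnergy {j k : ℕ} (hjk : j ≤ k) (hk : k ≤ r) (η : E) :
    ‖scaled μ Z k η‖ ^ 2 ≤ tailEnergy μ Z r j η := by
  have := single_le_sum (f := fun k => ‖scaled μ Z k η‖ ^ 2) (s := Icc j r)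
    (fun _ _ => by positivity) (mem_Icc.2 ⟨hjk, hk⟩)
  unfold tailEnergy
  linarith

theorem tailEnergy_eq_add {j : ℕ} (hj : j ≤ r) (η : E) :
    tailEnergy μ Z r j η = tailEnergy μ Z r (j + 1) η + ‖scaled μ Z j η‖ ^ 2 := by
  unfold tailEnergy
  rw [← Finset.insert_Icc_add_one_left_eq_Icc hj, sum_insert (by simp)]
  ring

theorem energyFraction_nonneg (j : ℕ) (η : E) : 0 ≤ energyFraction μ Z r j η :=
  div_nonneg (by positivity) (tailEnergy_pos j η).le

theorem energyFraction_le_one {j : ℕ} (hj : j ≤ r) (η : E) : energyFraction μ Z r j η ≤ 1 :=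
  div_le_one_of_le₀ (sq_norm_scaled_le_tailEnergy le_rfl hj η) (tailEnergy_pos j η).le

theorem norm_scaled_eq (j : ℕ) (η : E) :
    ‖scaled μ Z j η‖ = √(energyFraction μ Z r j η) * √(tailEnergy μ Z r j η) := by
  rw [energyFraction, ← Real.sqrt_mul (div_nonneg (by positivity) (tailEnergy_pos j η).le),
    div_mul_cancel₀ _ (tailEnergy_pos j η).ne', Real.sqrt_sq (norm_nonneg _)]

/-- Level `j + 1` dominates the energy above level `j` as soon as level `j` itself does not. -/
theorem energyFraction_sub_le {j : ℕ} (hj : j + 1 ≤ r) (η : E) :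
    energyFraction μ Z r (j + 1) η - √(energyFraction μ Z r j η) ≤
      ‖scaled μ Z (j + 1) η‖ ^ 2 / tailEnergy μ Z r j η := by
  have h0 := energyFraction_nonneg (μ := μ) (Z := Z) (r := r) j η
  have h1 := energyFraction_le_one (μ := μ) (Z := Z) (r := r) (j := j) (by omega) η
  have h2 := energyFraction_nonneg (μ := μ) (Z := Z) (r := r) (j + 1) η
  have h3 := energyFraction_le_one (μ := μ) (Z := Z) hj η
  have hD := tailEnergy_pos (μ := μ) (Z := Z) (r := r) j η
  have hD' := tailEnergy_pos (μ := μ) (Z := Z) (r := r) (j + 1) η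
  have key : ‖scaled μ Z (j + 1) η‖ ^ 2 / tailEnergy μ Z r j η =
      energyFraction μ Z r (j + 1) η * (1 - energyFraction μ Z r j η) := by
    have e := tailEnergy_eq_add (μ := μ) (Z := Z) (r := r) (j := j) (by omega) η
    unfold energyFraction
    field_simp
    rw [e]
    ring
  have hs : energyFraction μ Z r j η ≤ √(energyFraction μ Z r j η) :=
    Real.le_sqrt_of_sq_le (by nlinarith)
  rw [key]
  nlinarith

/-! ### Derivatives along the linear flow -/

theorem hasDerivAt_bracket_rpow {γ : ℝ → E} {v : E} {t : ℝ} (hγ : HasDerivAt γ v t) (a : ℝ) :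
    HasDerivAt (fun s => bracket (γ s) ^ a)
      (a * (inner ℝ (γ t) v / bracket (γ t) ^ 2) * bracket (γ t) ^ a) t := by
  have h1 : HasDerivAt (fun s => bracket (γ s)) (inner ℝ (γ t) v / bracket (γ t)) t := by
    have h := (hγ.norm_sq.const_add 1).sqrt (by positivity)
    rw [mul_div_mul_left _ _ two_ne_zero] at h
    exact h
  have h2 := h1.rpow_const (p := a) (Or.inl (bracket_pos _).ne')
  convert h2 using 1
  rw [Real.rpow_sub_one (bracket_pos _).ne']
  have := (bracket_pos (γ t)).ne'
  field_simp

/-- Along the flow of `M`, the rescaled chain is again a chain up to the logarithmic derivative of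
the bracket. -/
theorem hasDerivAt_scaled {M : E →L[ℝ] E} (hZ : ∀ k η, Z k (M η) = Z (k + 1) η) {γ : ℝ → E} {t : ℝ}
    (hγ : HasDerivAt γ (M (γ t)) t) (k : ℕ) :
    HasDerivAt (fun s => scaled μ Z k (γ s))
      (bracket (γ t) ^ (μ (k + 1) - μ k) • scaled μ Z (k + 1) (γ t) -
        (μ k * (inner ℝ (γ t) (M (γ t)) / bracket (γ t) ^ 2)) • scaled μ Z k (γ t)) t := by
  have h := (hasDerivAt_bracket_rpow hγ (-μ k)).smul ((Z k).hasFDerivAt.comp_hasDerivAt t hγ)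
  convert! h using 1
  simp only [scaled, hZ, smul_smul, ← Real.rpow_add (bracket_pos _), Function.comp_apply]
  rw [sub_eq_add_neg, ← neg_smul]
  congr 3
  · ring
  · ring

theorem abs_inner_div_bracket_sq_le (M : E →L[ℝ] E) (η : E) :
    |inner ℝ η (M η) / bracket η ^ 2| ≤ ‖M‖ := by
  rw [abs_div, abs_of_pos (a := bracket η ^ 2) (pow_pos (bracket_pos η) 2),
    div_le_iff₀ (pow_pos (bracket_pos η) 2)]
  calc |inner ℝ η (M η)| ≤ ‖η‖ * ‖M η‖ := abs_real_inner_le_norm _ _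
    _ ≤ ‖η‖ * (‖M‖ * ‖η‖) := by gcongr; exact M.le_opNorm η
    _ = ‖M‖ * ‖η‖ ^ 2 := by ring
    _ ≤ ‖M‖ * bracket η ^ 2 := by
      rw [bracket_sq]
      gcongr
      linarith

/-- The weight at level `j` is small where level `j` carries little energy. -/
theorem abs_inner_div_tailEnergy_le {j : ℕ} (hj : j + 1 ≤ r) (η : E) :
    |inner ℝ (scaled μ Z j η) (scaled μ Z (j + 1) η) / tailEnergy μ Z r j η| ≤
      √(energyFraction μ Z r j η) := by
  have hD := tailEnergy_pos (μ := μ) (Z := Z) (r := r) j η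
  rw [abs_div, abs_of_pos hD, div_le_iff₀ hD]
  have h2 : ‖scaled μ Z (j + 1) η‖ ≤ √(tailEnergy μ Z r j η) :=
    Real.le_sqrt_of_sq_le (sq_norm_scaled_le_tailEnergy (Nat.le_succ j) hj η)
  calc _ ≤ ‖scaled μ Z j η‖ * ‖scaled μ Z (j + 1) η‖ := abs_real_inner_le_norm _ _
    _ ≤ (√(energyFraction μ Z r j η) * √(tailEnergy μ Z r j η)) * √(tailEnergy μ Z r j η) := by
      rw [norm_scaled_eq (r := r)]
      gcongr
    _ = _ := by rw [mul_assoc, Real.mul_self_sqrt hD.le]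

theorem abs_chainWeight_le {κ : ℝ} {j : ℕ} (hj : j + 1 ≤ r) (η : E) :
    |chainWeight μ Z r κ j η| ≤
      bracket η ^ (κ + μ j - μ (j + 1)) * √(energyFraction μ Z r j η) := by
  rw [chainWeight, mul_div_assoc, abs_mul, abs_of_pos (Real.rpow_pos_of_pos (bracket_pos η) _)]
  gcongr
  · exact (Real.rpow_pos_of_pos (bracket_pos η) _).le
  · exact abs_inner_div_tailEnergy_le hj η

theorem abs_chainWeight_le_sqrt {κ : ℝ} {j : ℕ} (hj : j + 1 ≤ r) (hμ : μ j ≤ μ (j + 1)) (η : E) :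
    |chainWeight μ Z r κ j η| ≤ bracket η ^ κ * √(energyFraction μ Z r j η) := by
  refine (abs_chainWeight_le hj η).trans ?_
  gcongr
  · exact one_le_bracket η
  · linarith

/-- The square root of the energy fraction is at most `min 1 ‖scaled j‖`, hence at most any power
of `‖scaled j‖` with exponent in `[0, 1]`. -/
theorem sqrt_energyFraction_le_rpow {j : ℕ} (hj : j ≤ r) {q : ℝ} (hq0 : 0 ≤ q) (hq1 : q ≤ 1)
    (η : E) : √(energyFraction μ Z r j η) ≤ ‖scaled μ Z j η‖ ^ q := by
  rcases le_total ‖scaled μ Z j η‖ 1 with h | h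
  · calc √(energyFraction μ Z r j η) ≤ ‖scaled μ Z j η‖ :=
          Real.sqrt_le_iff.2 ⟨norm_nonneg _,
            div_le_self (by positivity) (one_le_tailEnergy j η)⟩
      _ ≤ _ := by
          simpa using Real.rpow_le_rpow_of_exponent_ge' (norm_nonneg _) h hq0 hq1
  · calc √(energyFraction μ Z r j η) ≤ 1 :=
          Real.sqrt_le_one.2 (energyFraction_le_one hj η)
      _ ≤ _ := Real.one_le_rpow h hq0

end pointwise

end

section

open Finset

variable {E F : Type*} [NormedAddCommGroup E] [InnerProductSpace ℝ E]
  [NormedAddCommGroup F] [InnerProductSpace ℝ F]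

section pointwise

variable {μ : ℕ → ℝ} {Z : ℕ → E →L[ℝ] F} {r : ℕ}

/-- The admissible exponents of a chain of length `r`: nondecreasing in `[0, 1]`, concave, and
equal to `1` from the index `r` on. -/
structure IsScale (μ : ℕ → ℝ) (r : ℕ) : Prop where
  nonneg : ∀ k, 0 ≤ μ k
  le_one : ∀ k, μ k ≤ 1
  mono : ∀ k, μ k ≤ μ (k + 1)
  concave : ∀ k, μ (k + 2) - μ (k + 1) ≤ μ (k + 1) - μ k
  top : ∀ k, r ≤ k → μ k = 1

theorem IsScale.increment_le (h : IsScale μ r) {j k : ℕ} (hjk : j ≤ k) :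
    μ (k + 1) - μ k ≤ μ (j + 1) - μ j := by
  induction k, hjk using Nat.le_induction with
  | base => rfl
  | succ k _ ih => exact (h.concave k).trans ih

/-- Every level from `j` on is controlled by the tail energy, including level `r + 1`, which is not
part of it but is bounded because `μ (r + 1) = 1`. -/
theorem norm_scaled_le_tailEnergy (hμ : IsScale μ r) {j k : ℕ} (hjk : j ≤ k)
    (hk : k ≤ r + 1) (η : E) :
    ‖scaled μ Z k η‖ ≤ (1 + ‖Z (r + 1)‖) * √(tailEnergy μ Z r j η) := by
  rcases Nat.lt_or_ge r k with h | h
  · obtain rfl : k = r + 1 := by omega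
    have h1 : ‖scaled μ Z (r + 1) η‖ ≤ ‖Z (r + 1)‖ := by
      have hR := bracket_pos η
      rw [scaled, hμ.top _ (Nat.le_succ r), norm_smul, Real.rpow_neg_one, norm_inv,
        Real.norm_of_nonneg hR.le, inv_mul_le_iff₀ hR]
      calc ‖Z (r + 1) η‖ ≤ ‖Z (r + 1)‖ * ‖η‖ := (Z (r + 1)).le_opNorm η
        _ ≤ ‖Z (r + 1)‖ * bracket η := by gcongr; exact norm_le_bracket η
        _ = _ := mul_comm _ _
    have h2 : 1 ≤ √(tailEnergy μ Z r j η) := Real.one_le_sqrt.2 (one_le_tailEnergy j η)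
    nlinarith [norm_nonneg (Z (r + 1))]
  · have h1 : ‖scaled μ Z k η‖ ≤ √(tailEnergy μ Z r j η) :=
      Real.le_sqrt_of_sq_le (sq_norm_scaled_le_tailEnergy hjk h η)
    nlinarith [norm_nonneg (Z (r + 1)), Real.sqrt_nonneg (tailEnergy μ Z r j η)]

/-- The logarithmic derivative of the tail energy is at most the rate of its fastest level. -/
theorem exists_hasDerivAt_tailEnergy (hμ : IsScale μ r) {M : E →L[ℝ] E}
    (hZ : ∀ k η, Z k (M η) = Z (k + 1) η) {γ : ℝ → E} {t : ℝ}
    (hγ : HasDerivAt γ (M (γ t)) t) (j : ℕ) :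
    ∃ d, HasDerivAt (fun s => tailEnergy μ Z r j (γ s)) d t ∧
      |d| ≤ (r + 1) * (2 * (1 + ‖Z (r + 1)‖ + ‖M‖)) *
        bracket (γ t) ^ (μ (j + 1) - μ j) * tailEnergy μ Z r j (γ t) := by
  refine ⟨_, (HasDerivAt.fun_sum fun k _ =>
    (hasDerivAt_scaled (μ := μ) hZ hγ k).norm_sq).const_add 1, ?_⟩
  set η := γ t
  set D := tailEnergy μ Z r j η
  have hD : 0 < D := tailEnergy_pos j η
  set ρ := bracket η ^ (μ (j + 1) - μ j)
  have hρ : 1 ≤ ρ := Real.one_le_rpow (one_le_bracket η) (sub_nonneg.2 (hμ.mono j))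
  refine (abs_sum_le_sum_abs _ _).trans ?_
  have hterm : ∀ k ∈ Icc j r, |2 * inner ℝ (scaled μ Z k η)
      (bracket η ^ (μ (k + 1) - μ k) • scaled μ Z (k + 1) η -
        (μ k * (inner ℝ η (M η) / bracket η ^ 2)) • scaled μ Z k η)| ≤
      2 * (1 + ‖Z (r + 1)‖ + ‖M‖) * ρ * D := by
    intro k hk
    rw [mem_Icc] at hk
    have hβ := abs_inner_div_bracket_sq_le M η
    set β := inner ℝ η (M η) / bracket η ^ 2
    have hρk : bracket η ^ (μ (k + 1) - μ k) ≤ ρ :=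
      Real.rpow_le_rpow_of_exponent_le (one_le_bracket η) (hμ.increment_le hk.1)
    have hρk0 : 0 ≤ bracket η ^ (μ (k + 1) - μ k) :=
      (Real.rpow_pos_of_pos (bracket_pos η) _).le
    have h1 : ‖scaled μ Z k η‖ ≤ √D :=
      Real.le_sqrt_of_sq_le (sq_norm_scaled_le_tailEnergy hk.1 hk.2 η)
    have h2 : ‖scaled μ Z (k + 1) η‖ ≤ (1 + ‖Z (r + 1)‖) * √D :=
      norm_scaled_le_tailEnergy hμ (by omega) (by omega) η
    have h3 : |μ k * β| ≤ ‖M‖ := by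
      rw [abs_mul, abs_of_nonneg (hμ.nonneg k)]
      calc μ k * |β| ≤ 1 * ‖M‖ := by
            gcongr
            exact hμ.le_one k
        _ = ‖M‖ := one_mul _
    rw [abs_mul, abs_two]
    calc 2 * |inner ℝ (scaled μ Z k η) (bracket η ^ (μ (k + 1) - μ k) • scaled μ Z (k + 1) η -
          (μ k * β) • scaled μ Z k η)|
        ≤ 2 * (‖scaled μ Z k η‖ * (bracket η ^ (μ (k + 1) - μ k) * ‖scaled μ Z (k + 1) η‖ +
            |μ k * β| * ‖scaled μ Z k η‖)) := by
          gcongr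
          refine (abs_real_inner_le_norm _ _).trans ?_
          gcongr
          refine (norm_sub_le _ _).trans_eq ?_
          rw [norm_smul, norm_smul, Real.norm_of_nonneg hρk0, Real.norm_eq_abs]
      _ ≤ 2 * (√D * (ρ * ((1 + ‖Z (r + 1)‖) * √D) + (‖M‖ * ρ) * √D)) := by
          gcongr
          exact h3.trans (le_mul_of_one_le_right (norm_nonneg M) hρ)
      _ = 2 * (1 + ‖Z (r + 1)‖ + ‖M‖) * ρ * (√D * √D) := by ring
      _ = _ := by rw [Real.mul_self_sqrt hD.le]
  refine (sum_le_sum hterm).trans ?_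
  rw [sum_const, nsmul_eq_mul]
  have hcard : ((Icc j r).card : ℝ) ≤ r + 1 := by
    rw [Nat.card_Icc]
    exact_mod_cast Nat.sub_le _ _
  calc _ ≤ ((r : ℝ) + 1) * (2 * (1 + ‖Z (r + 1)‖ + ‖M‖) * ρ * D) := by gcongr
    _ = _ := by ring

/-- The derivative of the weight along the flow bounds the energy fraction of level `j + 1` from
below, up to a multiple of the square root of the energy fraction of level `j`. Concavity of the
exponents enters here: it makes all the levels above `j` evolve no faster than level `j`. -/
theorem exists_hasDerivAt_chainWeight (hμ : IsScale μ r) {M : E →L[ℝ] E}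
    (hZ : ∀ k η, Z k (M η) = Z (k + 1) η) {κ : ℝ} (hκ : 0 ≤ κ) {j : ℕ} (hj : j + 1 ≤ r) :
    ∃ C, 0 ≤ C ∧ ∀ (γ : ℝ → E) (t : ℝ), HasDerivAt γ (M (γ t)) t →
      ∃ d, HasDerivAt (fun s => chainWeight μ Z r κ j (γ s)) d t ∧
        bracket (γ t) ^ κ * (energyFraction μ Z r (j + 1) (γ t) -
          C * √(energyFraction μ Z r j (γ t))) ≤ d := by
  set C₀ := 1 + ‖Z (r + 1)‖ with hC₀
  set C₁ := (r + 1 : ℝ) * (2 * (C₀ + ‖M‖)) with hC₁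
  have hC₀0 : 0 ≤ C₀ := by positivity
  have hC₁0 : 0 ≤ C₁ := by positivity
  refine ⟨1 + (κ + 2) * ‖M‖ + C₀ + C₁, by positivity, fun γ t hγ => ?_⟩
  obtain ⟨D', hD', hD'le⟩ := exists_hasDerivAt_tailEnergy hμ hZ hγ j
  have hD := tailEnergy_pos (μ := μ) (Z := Z) (r := r) j (γ t)
  refine ⟨_, ((hasDerivAt_bracket_rpow hγ (κ + μ j - μ (j + 1))).mul
    ((hasDerivAt_scaled (μ := μ) hZ hγ j).inner ℝ (hasDerivAt_scaled (μ := μ) hZ hγ (j + 1)))).div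
    hD' hD.ne', ?_⟩
  have hmain := energyFraction_sub_le (μ := μ) (Z := Z) hj (γ t)
  have hPS := abs_inner_div_tailEnergy_le (μ := μ) (Z := Z) hj (γ t)
  have hnorm := norm_scaled_eq (μ := μ) (Z := Z) (r := r) j (γ t)
  have hy2 := norm_scaled_le_tailEnergy (Z := Z) hμ (Nat.le_add_right j 2) (by omega) (γ t)
  have hβ := abs_inner_div_bracket_sq_le M (γ t)
  set η := γ t
  set D := tailEnergy μ Z r j η
  set S := √(energyFraction μ Z r j η)
  set β := inner ℝ η (M η) / bracket η ^ 2
  set y₀ := scaled μ Z j η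
  set y₁ := scaled μ Z (j + 1) η
  set y₂ := scaled μ Z (j + 2) η
  have hR := bracket_pos η
  have hS : 0 ≤ S := Real.sqrt_nonneg _
  -- `R * ρ` is the common size of all the terms
  set R := bracket η ^ (κ + μ j - μ (j + 1)) with hRdef
  set ρ := bracket η ^ (μ (j + 1) - μ j) with hρdef
  set ρ' := bracket η ^ (μ (j + 1 + 1) - μ (j + 1)) with hρ'def
  have hRρ : bracket η ^ κ = R * ρ := by
    rw [hRdef, hρdef, ← Real.rpow_add hR]
    congr 1
    ring
  have hR0 : 0 < R := Real.rpow_pos_of_pos hR _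
  have hρ0 : 0 < ρ := Real.rpow_pos_of_pos hR _
  have hρ'0 : 0 < ρ' := Real.rpow_pos_of_pos hR _
  have hρ1 : 1 ≤ ρ := Real.one_le_rpow (one_le_bracket η) (sub_nonneg.2 (hμ.mono j))
  have hρ' : ρ' ≤ ρ :=
    Real.rpow_le_rpow_of_exponent_le (one_le_bracket η) (hμ.increment_le (Nat.le_succ j))
  set P := inner ℝ y₀ y₁
  have hT1 : |(κ - 2 * μ (j + 1)) * β * (P / D)| ≤ ρ * ((κ + 2) * ‖M‖ * S) := by
    have h1 : |κ - 2 * μ (j + 1)| ≤ κ + 2 := by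
      rw [abs_le]
      constructor <;> linarith [hμ.nonneg (j + 1), hμ.le_one (j + 1)]
    rw [abs_mul, abs_mul]
    calc _ ≤ (κ + 2) * ‖M‖ * S := by gcongr
      _ ≤ _ := le_mul_of_one_le_left (by positivity) hρ1
  have hT2 : |ρ' * (inner ℝ y₀ y₂ / D)| ≤ ρ * (C₀ * S) := by
    rw [abs_mul, abs_of_pos hρ'0]
    gcongr
    rw [abs_div, abs_of_pos hD, div_le_iff₀ hD]
    calc |inner ℝ y₀ y₂| ≤ ‖y₀‖ * ‖y₂‖ := abs_real_inner_le_norm _ _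
      _ ≤ (S * √D) * (C₀ * √D) := by
        rw [hnorm]
        gcongr
      _ = C₀ * S * (√D * √D) := by ring
      _ = _ := by rw [Real.mul_self_sqrt hD.le]
  have hT3 : |(P / D) * (D' / D)| ≤ ρ * (C₁ * S) := by
    rw [abs_mul]
    have h1 : |D' / D| ≤ C₁ * ρ := by
      rw [abs_div, abs_of_pos hD, div_le_iff₀ hD]
      exact hD'le
    calc _ ≤ S * (C₁ * ρ) := by gcongr
      _ = _ := by ring
  have hT0 : ρ * (energyFraction μ Z r (j + 1) η - S) ≤ ρ * (‖y₁‖ ^ 2 / D) := by gcongr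
  have hd : ((κ + μ j - μ (j + 1)) * β * R * P + R * (inner ℝ y₀
        (ρ' • y₂ - (μ (j + 1) * β) • y₁) + inner ℝ (ρ • y₁ - (μ j * β) • y₀) y₁)) * D -
        R * P * D' = R * D ^ 2 * (ρ * (‖y₁‖ ^ 2 / D) + (κ - 2 * μ (j + 1)) * β * (P / D) +
          ρ' * (inner ℝ y₀ y₂ / D) - (P / D) * (D' / D)) := by
    have e1 : inner ℝ y₀ (ρ' • y₂ - (μ (j + 1) * β) • y₁) =
        ρ' * inner ℝ y₀ y₂ - μ (j + 1) * β * P := by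
      rw [inner_sub_right, real_inner_smul_right, real_inner_smul_right]
    have e2 : inner ℝ (ρ • y₁ - (μ j * β) • y₀) y₁ = ρ * ‖y₁‖ ^ 2 - μ j * β * P := by
      rw [inner_sub_left, real_inner_smul_left, real_inner_smul_left, real_inner_self_eq_norm_sq]
    rw [e1, e2]
    field_simp
    ring
  rw [hRρ, mul_assoc]
  refine le_trans ?_ (le_of_eq (a := R * (ρ * (‖y₁‖ ^ 2 / D) + (κ - 2 * μ (j + 1)) * β * (P / D) +
          ρ' * (inner ℝ y₀ y₂ / D) - (P / D) * (D' / D))) ?_)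
  · gcongr
    rw [abs_le] at hT1 hT2 hT3
    linarith [hT1.1, hT2.1, hT3.2]
  · rw [eq_div_iff (by positivity)]
    refine Eq.trans ?_ hd.symm
    ring

end pointwise

end

section

open Finset MeasureTheory

section temperate

variable {E F : Type*} [NormedAddCommGroup E] [InnerProductSpace ℝ E]
  [NormedAddCommGroup F] [InnerProductSpace ℝ F]

/-! ### Temperate growth of the weights -/

theorem hasTemperateGrowth_inner {f g : E → F} (hf : f.HasTemperateGrowth)
    (hg : g.HasTemperateGrowth) : (fun x => inner ℝ (f x) (g x)).HasTemperateGrowth :=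
  (innerSL ℝ).bilinear_hasTemperateGrowth hf hg

theorem hasTemperateGrowth_norm_sq_comp {f : E → F} (hf : f.HasTemperateGrowth) :
    (fun x => ‖f x‖ ^ 2).HasTemperateGrowth :=
  (Function.hasTemperateGrowth_norm_sq F).comp hf

theorem hasTemperateGrowth_inv_one_add_sum_norm_sq {ι : Type*} (s : Finset ι) {f : ι → E → F}
    (hf : ∀ i, (f i).HasTemperateGrowth) :
    (fun x => (1 + ∑ i ∈ s, ‖f i x‖ ^ 2)⁻¹).HasTemperateGrowth := by
  classical
  -- the sum of squares is the squared norm of the tuple `(f i)`, whose Bessel potential is tempered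
  let L : s → F →L[ℝ] PiLp 2 fun _ : s => F := fun i =>
    (PiLp.continuousLinearEquiv 2 ℝ fun _ : s => F).symm.toContinuousLinearMap ∘L
      ContinuousLinearMap.single ℝ (fun _ : s => F) i
  let Y : E → PiLp 2 fun _ : s => F := fun x => ∑ i, L i (f i x)
  have hY : Y.HasTemperateGrowth := by
    refine Function.HasTemperateGrowth.sum fun i _ => ?_
    exact (L i).hasTemperateGrowth.comp (hf i)
  have hYi : ∀ x (i : s), Y x i = f i x := by
    intro x i
    simp [Y, L, Pi.single_apply]
  have h := (Function.hasTemperateGrowth_one_add_norm_sq_rpow (PiLp 2 fun _ : s => F) (-1)).comp hY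
  convert! h using 1
  funext x
  rw [Function.comp_apply, Real.rpow_neg_one, PiLp.norm_sq_eq_of_L2, ← Finset.sum_coe_sort]
  simp only [hYi]

variable {μ : ℕ → ℝ} {Z : ℕ → E →L[ℝ] F} {r : ℕ}

theorem hasTemperateGrowth_scaled (k : ℕ) : (scaled μ Z k).HasTemperateGrowth :=
  (bracket_rpow_hasTemperateGrowth (-μ k)).smul (Z k).hasTemperateGrowth

theorem hasTemperateGrowth_inv_tailEnergy (j : ℕ) :
    (fun η => (tailEnergy μ Z r j η)⁻¹).HasTemperateGrowth :=
  hasTemperateGrowth_inv_one_add_sum_norm_sq (Icc j r) hasTemperateGrowth_scaled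

theorem hasTemperateGrowth_energyFraction (j : ℕ) :
    (energyFraction μ Z r j).HasTemperateGrowth :=
  (hasTemperateGrowth_norm_sq_comp (hasTemperateGrowth_scaled j)).mul
    (hasTemperateGrowth_inv_tailEnergy j)

theorem hasTemperateGrowth_chainWeight (κ : ℝ) (j : ℕ) :
    (chainWeight μ Z r κ j).HasTemperateGrowth :=
  ((bracket_rpow_hasTemperateGrowth (κ + μ j - μ (j + 1))).mul
    (hasTemperateGrowth_inner (hasTemperateGrowth_scaled j) (hasTemperateGrowth_scaled (j + 1)))).mul
    (hasTemperateGrowth_inv_tailEnergy j)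

end temperate

/-! ### Weighted densities and integration by parts along a linear vector field -/

section densities

variable {m : ℕ}

/-- The Schwartz function `w * ‖f‖²`, for a weight `w` of temperate growth. -/
def density (w : EuclideanSpace ℝ (Fin m) → ℝ) (f : 𝓢(EuclideanSpace ℝ (Fin m), ℂ)) :
    𝓢(EuclideanSpace ℝ (Fin m), ℝ) :=
  SchwartzMap.smulLeftCLM ℝ w (SchwartzMap.bilinLeftCLM (innerSL ℝ) f.hasTemperateGrowth f)

theorem density_apply {w : EuclideanSpace ℝ (Fin m) → ℝ} (hw : w.HasTemperateGrowth)
    (f : 𝓢(EuclideanSpace ℝ (Fin m), ℂ)) (ζ : EuclideanSpace ℝ (Fin m)) :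
    density w f ζ = w ζ * ‖f ζ‖ ^ 2 := by
  rw [density, SchwartzMap.smulLeftCLM_apply_apply hw, SchwartzMap.bilinLeftCLM_apply,
    smul_eq_mul]
  congr 1
  exact real_inner_self_eq_norm_sq (f ζ)

theorem integrable_mul_norm_sq {w : EuclideanSpace ℝ (Fin m) → ℝ} (hw : w.HasTemperateGrowth)
    (f : 𝓢(EuclideanSpace ℝ (Fin m), ℂ)) : Integrable fun ζ => w ζ * ‖f ζ‖ ^ 2 :=
  (density w f).integrable.congr (.of_forall fun ζ => density_apply hw f ζ)

theorem fderiv_apply_eq_sum (F : 𝓢(EuclideanSpace ℝ (Fin m), ℝ))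
    (ζ v : EuclideanSpace ℝ (Fin m)) :
    fderiv ℝ F ζ v = ∑ i, v i * fderiv ℝ F ζ (EuclideanSpace.single i 1) := by
  conv_lhs => rw [← (EuclideanSpace.basisFun (Fin m) ℝ).sum_repr v]
  simp [map_sum]

theorem integrable_fderiv_apply_linear (A : EuclideanSpace ℝ (Fin m) →L[ℝ] EuclideanSpace ℝ (Fin m))
    (F : 𝓢(EuclideanSpace ℝ (Fin m), ℝ)) (i : Fin m) :
    Integrable fun ζ => A ζ i * fderiv ℝ F ζ (EuclideanSpace.single i 1) := by
  have hA : (fun ζ => A ζ i).HasTemperateGrowth :=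
    ((EuclideanSpace.proj i : EuclideanSpace ℝ (Fin m) →L[ℝ] ℝ) ∘L A).hasTemperateGrowth
  refine (SchwartzMap.smulLeftCLM ℝ (fun ζ => A ζ i)
    (LineDeriv.lineDerivOp (EuclideanSpace.single i (1 : ℝ)) F)).integrable.congr
    (.of_forall fun ζ => ?_)
  rw [SchwartzMap.smulLeftCLM_apply_apply hA, SchwartzMap.lineDerivOp_apply_eq_fderiv, smul_eq_mul]

/-- The divergence theorem for `F` times the linear vector field `A`, whose divergence is
constant. -/
theorem integral_fderiv_apply_linear (A : EuclideanSpace ℝ (Fin m) →L[ℝ] EuclideanSpace ℝ (Fin m))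
    (F : 𝓢(EuclideanSpace ℝ (Fin m), ℝ)) :
    Integrable (fun ζ => fderiv ℝ F ζ (A ζ)) ∧
    ∫ ζ, fderiv ℝ F ζ (A ζ) = -(∑ i, A (EuclideanSpace.single i 1) i) * ∫ ζ, F ζ := by
  have hint := integrable_fderiv_apply_linear A F
  have hI : ∀ i, ∫ ζ, A ζ i * fderiv ℝ F ζ (EuclideanSpace.single i 1) =
      -(A (EuclideanSpace.single i 1) i * ∫ ζ, F ζ) := by
    intro i
    let l : EuclideanSpace ℝ (Fin m) →L[ℝ] ℝ := EuclideanSpace.proj i ∘L A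
    have hl : ∀ ζ, fderiv ℝ (fun ζ => A ζ i) ζ = l := fun ζ => l.fderiv
    have hFl : Integrable fun ζ => A ζ i * F ζ := by
      refine (SchwartzMap.smulLeftCLM ℝ l F).integrable.congr (.of_forall fun ζ => ?_)
      rw [SchwartzMap.smulLeftCLM_apply_apply l.hasTemperateGrowth]
      rfl
    rw [integral_mul_fderiv_eq_neg_fderiv_mul_of_integrable (𝕜 := ℝ) (f := fun ζ => A ζ i)
      (g := F) ?_ (hint i) hFl (fun ζ _ => l.differentiableAt) (fun ζ _ => F.differentiableAt)]
    · simp only [hl, integral_const_mul]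
      rfl
    · simp only [hl]
      exact F.integrable.const_mul _
  have e : (fun ζ => fderiv ℝ F ζ (A ζ)) =
      fun ζ => ∑ i, A ζ i * fderiv ℝ F ζ (EuclideanSpace.single i 1) := by
    funext ζ
    exact fderiv_apply_eq_sum F ζ (A ζ)
  rw [e]
  refine ⟨integrable_finsetSum _ fun i _ => hint i, ?_⟩
  rw [integral_finsetSum _ fun i _ => hint i, neg_mul, sum_mul, ← sum_neg_distrib]
  exact sum_congr rfl fun i _ => hI i

end densities

end

section

open Finset MeasureTheory

variable {m : ℕ} {V F : Type*} [NormedAddCommGroup V] [InnerProductSpace ℝ V]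
  [NormedAddCommGroup F] [InnerProductSpace ℝ F]

/-! ### The chain of energy estimates -/

/-- The weight `⟨η⟩ ^ s * ⟨Z j η⟩ ^ q` on the source term at level `j`. -/
def sourceWeight (Z : ℕ → V →L[ℝ] F) (q s : ℕ → ℝ) (j : ℕ) (η : V) : ℝ :=
  bracket η ^ s j * bracket (Z j η) ^ q j

/-- `h` is the image of `f` under the transport operator read on the Fourier side:
`h = iθ f - A·∇f - b f` with a real function `θ`, for the linear vector field `A`. -/
def IsTransportSource (A : EuclideanSpace ℝ (Fin m) →L[ℝ] EuclideanSpace ℝ (Fin m)) (b : ℝ)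
    (f h : 𝓢(EuclideanSpace ℝ (Fin m), ℂ)) : Prop :=
  ∃ θ : EuclideanSpace ℝ (Fin m) → ℝ, ∀ ζ,
    h ζ = θ ζ * Complex.I * f ζ - fderiv ℝ f ζ (A ζ) - b * f ζ

theorem bracket_comp_rpow_hasTemperateGrowth (L : V →L[ℝ] F) (a : ℝ) :
    (fun η => bracket (L η) ^ a).HasTemperateGrowth :=
  (bracket_rpow_hasTemperateGrowth a).comp L.hasTemperateGrowth

theorem sourceWeight_hasTemperateGrowth (Z : ℕ → V →L[ℝ] F) (q s : ℕ → ℝ) (j : ℕ) :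
    (sourceWeight Z q s j).HasTemperateGrowth :=
  (bracket_rpow_hasTemperateGrowth (s j)).mul (bracket_comp_rpow_hasTemperateGrowth (Z j) (q j))

section weights

variable {μ : ℕ → ℝ} {Z : ℕ → V →L[ℝ] F} {r : ℕ} {q s : ℕ → ℝ}

/-- The condition on `s j` is what is needed to bound the chain weight by the source weight times
`⟨η⟩ ^ (κ / 2)`, the square root of the target weight. It uses `q j ≤ 1`: the chain weight vanishes
only to first order in level `j`. -/
theorem abs_chainWeight_le_sourceWeight {κ : ℝ} {j : ℕ} (hj : j + 1 ≤ r)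
    (hq0 : 0 ≤ q j) (hq1 : q j ≤ 1) (hs : κ / 2 + (1 - q j) * μ j - μ (j + 1) ≤ s j) (η : V) :
    |chainWeight μ Z r κ j η| ≤ bracket η ^ (κ / 2) * sourceWeight Z q s j η := by
  have hR := bracket_pos η
  calc |chainWeight μ Z r κ j η|
      ≤ bracket η ^ (κ + μ j - μ (j + 1)) * ‖scaled μ Z j η‖ ^ q j := by
        refine (abs_chainWeight_le hj η).trans ?_
        gcongr
        exact sqrt_energyFraction_le_rpow (by omega) hq0 hq1 η
    _ = bracket η ^ (κ / 2 + (κ / 2 + (1 - q j) * μ j - μ (j + 1))) * ‖Z j η‖ ^ q j := by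
        rw [scaled, norm_smul, Real.norm_of_nonneg (Real.rpow_pos_of_pos hR _).le,
          Real.mul_rpow (Real.rpow_pos_of_pos hR _).le (norm_nonneg _), ← Real.rpow_mul hR.le,
          ← mul_assoc, ← Real.rpow_add hR]
        congr 2
        ring
    _ ≤ bracket η ^ (κ / 2 + s j) * bracket (Z j η) ^ q j := by
        gcongr
        · exact one_le_bracket η
        · exact norm_le_bracket _
    _ = _ := by rw [Real.rpow_add hR, sourceWeight, mul_assoc]

/-- Where level `0` carries energy, the bracket is controlled by `⟨Z 0 η⟩`. -/
theorem bracket_rpow_mul_energyFraction_zero_le {a : ℝ} (ha : 0 < a) {ε : ℝ} (hε : 0 < ε) (η : V) :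
    bracket η ^ (2 * (a * μ 0)) * energyFraction μ Z r 0 η ≤
      ε * bracket η ^ (2 * (a * μ 0)) + ε ^ (-a) * (bracket (Z 0 η) ^ a) ^ 2 := by
  have hR := bracket_pos η
  have hRκ : 0 < bracket η ^ (2 * (a * μ 0)) := Real.rpow_pos_of_pos hR _
  have h0 : 0 ≤ ε ^ (-a) * (bracket (Z 0 η) ^ a) ^ 2 := by positivity
  have hx1 : energyFraction μ Z r 0 η ≤ 1 := energyFraction_le_one (Nat.zero_le r) η
  have hxy : energyFraction μ Z r 0 η ≤ ‖scaled μ Z 0 η‖ ^ 2 :=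
    div_le_self (by positivity) (one_le_tailEnergy 0 η)
  rcases le_total (‖scaled μ Z 0 η‖ ^ 2) ε with h | h
  · nlinarith
  · have h1 : ε * bracket η ^ (2 * μ 0) ≤ bracket (Z 0 η) ^ 2 := by
      calc ε * bracket η ^ (2 * μ 0) ≤ ‖scaled μ Z 0 η‖ ^ 2 * bracket η ^ (2 * μ 0) := by gcongr
        _ = ‖Z 0 η‖ ^ 2 := by
          rw [scaled, norm_smul, Real.norm_of_nonneg (Real.rpow_pos_of_pos hR _).le, mul_pow,
            ← Real.rpow_mul_natCast hR.le, mul_right_comm, ← Real.rpow_add hR]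
          rw [show -μ 0 * ((2 : ℕ) : ℝ) + 2 * μ 0 = 0 by push_cast; ring, Real.rpow_zero, one_mul]
        _ ≤ _ := by gcongr; exact norm_le_bracket _
    have h2 : ε ^ a * bracket η ^ (2 * (a * μ 0)) ≤ (bracket (Z 0 η) ^ a) ^ 2 := by
      have := Real.rpow_le_rpow (by positivity) h1 ha.le
      rw [Real.mul_rpow hε.le (by positivity), ← Real.rpow_mul hR.le] at this
      calc _ = ε ^ a * bracket η ^ (2 * μ 0 * a) := by congr 2; ring
        _ ≤ _ := this
        _ = _ := by
          rw [← Real.rpow_natCast, ← Real.rpow_natCast, ← Real.rpow_mul (bracket_pos _).le,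
            ← Real.rpow_mul (bracket_pos _).le, mul_comm]
    have h3 : bracket η ^ (2 * (a * μ 0)) ≤ ε ^ (-a) * (bracket (Z 0 η) ^ a) ^ 2 := by
      calc _ = ε ^ (-a) * (ε ^ a * bracket η ^ (2 * (a * μ 0))) := by
            rw [← mul_assoc (ε ^ (-a)), ← Real.rpow_add hε, neg_add_cancel, Real.rpow_zero, one_mul]
        _ ≤ _ := by gcongr
    nlinarith [mul_pos hε hRκ]

/-- Away from the origin, some level of the chain carries a fixed fraction of the energy. -/
theorem exists_bracket_rpow_le_sum_energyFraction (hμ : IsScale μ r) {c : ℝ} (hc : 0 < c)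
    (hcoer : ∀ η, c * ‖η‖ ^ 2 ≤ ∑ k ∈ Icc 0 r, ‖Z k η‖ ^ 2) {κ : ℝ} (hκ : 0 ≤ κ) :
    ∃ C, 0 < C ∧ ∀ η, bracket η ^ κ ≤
      C * ∑ k ∈ Icc 0 r, bracket η ^ κ * energyFraction μ Z r k η + C := by
  have h2 : (0 : ℝ) < 2 ^ κ := Real.rpow_pos_of_pos two_pos _
  -- `(c + 2) / c` serves for `‖η‖ ≥ 1`, and `2 ^ κ` bounds the left-hand side for `‖η‖ ≤ 1`
  refine ⟨(c + 2) / c + 2 ^ κ, by positivity, fun η => ?_⟩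
  have hR := bracket_pos η
  have hRκ : 0 < bracket η ^ κ := Real.rpow_pos_of_pos hR _
  rw [← mul_sum]
  set X := ∑ k ∈ Icc 0 r, energyFraction μ Z r k η with hX
  have hX0 : 0 ≤ X := sum_nonneg fun k _ => energyFraction_nonneg k η
  rcases le_total ‖η‖ 1 with h | h
  · have hb : bracket η ≤ 2 := by
      rw [bracket, Real.sqrt_le_left two_pos.le]
      nlinarith [norm_nonneg η]
    have : bracket η ^ κ ≤ 2 ^ κ := Real.rpow_le_rpow hR.le hb hκ
    have h3 : 0 ≤ ((c + 2) / c + 2 ^ κ) * (bracket η ^ κ * X) := by positivity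
    have h4 : 0 ≤ (c + 2) / c := by positivity
    linarith
  · have hD := tailEnergy_pos (μ := μ) (Z := Z) (r := r) 0 η
    set T := ∑ k ∈ Icc 0 r, ‖scaled μ Z k η‖ ^ 2
    have hDT : tailEnergy μ Z r 0 η = 1 + T := rfl
    have hT : c / 2 ≤ T := by
      have hk : ∀ k ∈ Icc 0 r, ‖Z k η‖ ^ 2 / bracket η ^ 2 ≤ ‖scaled μ Z k η‖ ^ 2 := by
        intro k _
        rw [← div_pow, scaled, norm_smul, Real.norm_of_nonneg (Real.rpow_pos_of_pos hR _).le,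
          div_eq_inv_mul, ← Real.rpow_neg_one]
        gcongr
        · exact one_le_bracket η
        · exact hμ.le_one k
      have h5 := sum_le_sum hk
      rw [← sum_div] at h5
      refine le_trans ?_ h5
      rw [le_div_iff₀ (by positivity), bracket_sq]
      refine le_trans ?_ (hcoer η)
      nlinarith [mul_le_mul_of_nonneg_left (one_le_pow₀ h (n := 2)) hc.le]
    have hx : T / (1 + T) ≤ X := by
      rw [hX, sum_div]
      refine sum_le_sum fun k hk => ?_
      have hle : tailEnergy μ Z r k η ≤ 1 + T := by
        unfold tailEnergy
        gcongr
        exact sum_le_sum_of_subset_of_nonneg (Icc_subset_Icc_left (Nat.zero_le k))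
          fun _ _ _ => by positivity
      exact div_le_div_of_nonneg_left (by positivity) (tailEnergy_pos k η) hle
    have hxc : c / (c + 2) ≤ X := by
      refine le_trans ?_ hx
      rw [div_le_div_iff₀ (by positivity) (by linarith)]
      nlinarith
    have h6 : 1 ≤ (c + 2) / c * X := by
      calc (1 : ℝ) = (c + 2) / c * (c / (c + 2)) := by field_simp
        _ ≤ _ := by gcongr
    have h7 : bracket η ^ κ ≤ (c + 2) / c * (bracket η ^ κ * X) := by
      calc bracket η ^ κ = bracket η ^ κ * 1 := (mul_one _).symm
        _ ≤ bracket η ^ κ * ((c + 2) / c * X) := by gcongr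
        _ = _ := by ring
    have h8 : 0 ≤ 2 ^ κ * (bracket η ^ κ * X) := by positivity
    have h9 : 0 ≤ (c + 2) / c := by positivity
    linarith [add_mul ((c + 2) / c) (2 ^ κ) (bracket η ^ κ * X)]

end weights

section estimates

variable {μ : ℕ → ℝ} {Z : ℕ → V →L[ℝ] F} {r : ℕ} {q s : ℕ → ℝ}
  {A : EuclideanSpace ℝ (Fin m) →L[ℝ] EuclideanSpace ℝ (Fin m)} {M : V →L[ℝ] V}
  {p : EuclideanSpace ℝ (Fin m) →L[ℝ] V} {b κ : ℝ}

/-- The product rule for `w * ‖f‖²` along the flow; the skew-adjoint term `iθ` drops out. -/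
theorem fderiv_density_apply {w : EuclideanSpace ℝ (Fin m) → ℝ} (hw : w.HasTemperateGrowth)
    {f h : 𝓢(EuclideanSpace ℝ (Fin m), ℂ)} (hfh : IsTransportSource A b f h)
    {ζ : EuclideanSpace ℝ (Fin m)} {d : ℝ}
    (hd : HasDerivAt (fun t : ℝ => w (ζ + t • A ζ)) d 0) :
    fderiv ℝ (density w f) ζ (A ζ) =
      d * ‖f ζ‖ ^ 2 - 2 * b * (w ζ * ‖f ζ‖ ^ 2) - 2 * w ζ * inner ℝ (f ζ) (h ζ) := by
  obtain ⟨θ, hθ⟩ := hfh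
  have hline : HasDerivAt (fun t : ℝ => ζ + t • A ζ) (A ζ) 0 := by
    simpa using ((hasDerivAt_id (0 : ℝ)).smul_const (A ζ)).const_add ζ
  have h0 : ζ + (0 : ℝ) • A ζ = ζ := by simp
  have hf : HasDerivAt (fun t : ℝ => f (ζ + t • A ζ)) (fderiv ℝ f ζ (A ζ)) 0 := by
    have := (f.hasFDerivAt (ζ + (0 : ℝ) • A ζ)).comp_hasDerivAt (0 : ℝ) hline
    rwa [h0] at this
  have hF : HasDerivAt (fun t : ℝ => density w f (ζ + t • A ζ))
      (fderiv ℝ (density w f) ζ (A ζ)) 0 := by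
    have := ((density w f).hasFDerivAt (ζ + (0 : ℝ) • A ζ)).comp_hasDerivAt (0 : ℝ) hline
    rwa [h0] at this
  have hprod := hd.mul hf.norm_sq
  have hF' : HasDerivAt (fun t : ℝ => density w f (ζ + t • A ζ)) _ 0 :=
    hprod.congr_of_eventuallyEq (.of_forall fun t => density_apply hw f _)
  rw [hF.unique hF', h0]
  have hDf : fderiv ℝ f ζ (A ζ) = θ ζ * Complex.I * f ζ - b * f ζ - h ζ := by
    rw [hθ ζ]
    ring
  have hskew : inner ℝ (f ζ) (θ ζ * Complex.I * f ζ) = 0 := by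
    simp [Complex.inner]
    ring
  have hb : inner ℝ (f ζ) (b * f ζ) = b * ‖f ζ‖ ^ 2 := by
    rw [← Complex.real_smul, real_inner_smul_right, real_inner_self_eq_norm_sq]
  rw [hDf, inner_sub_right, inner_sub_right, hskew, hb]
  ring

/-- One step of the chain: the energy of level `j + 1` is controlled by that of level `j`. -/
theorem exists_integral_energyFraction_succ_le (hμ : IsScale μ r)
    (hZ : ∀ k η, Z k (M η) = Z (k + 1) η) (hp : ∀ ζ, p (A ζ) = M (p ζ)) (hκ : 0 ≤ κ)
    {j : ℕ} (hj : j + 1 ≤ r) (hq0 : 0 ≤ q j) (hq1 : q j ≤ 1)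
    (hs : κ / 2 + (1 - q j) * μ j - μ (j + 1) ≤ s j) {ε : ℝ} (hε : 0 < ε) :
    ∃ C, 0 ≤ C ∧ ∀ f h : 𝓢(EuclideanSpace ℝ (Fin m), ℂ), IsTransportSource A b f h →
      ∫ ζ, (bracket (p ζ) ^ κ * energyFraction μ Z r (j + 1) (p ζ)) * ‖f ζ‖ ^ 2 ≤
        ε * (∫ ζ, bracket (p ζ) ^ κ * ‖f ζ‖ ^ 2) +
        C * (∫ ζ, (bracket (p ζ) ^ κ * energyFraction μ Z r j (p ζ)) * ‖f ζ‖ ^ 2) +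
        C * ∫ ζ, sourceWeight Z q s j (p ζ) ^ 2 * ‖h ζ‖ ^ 2 := by
  obtain ⟨C₀, hC₀, hder⟩ := exists_hasDerivAt_chainWeight (μ := μ) (Z := Z) hμ hZ hκ hj
  set τ := ∑ i, A (EuclideanSpace.single i 1) i
  set C₁ := C₀ + |2 * b - τ| with hC₁
  refine ⟨C₁ ^ 2 / (2 * ε) + 2 / ε, by positivity, fun f h hfh => ?_⟩
  set C := C₁ ^ 2 / (2 * ε) + 2 / ε with hC
  have hwT : (fun ζ => chainWeight μ Z r κ j (p ζ)).HasTemperateGrowth :=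
    (hasTemperateGrowth_chainWeight κ j).comp p.hasTemperateGrowth
  have hbT := bracket_comp_rpow_hasTemperateGrowth p κ
  have hxT : ∀ k, (fun ζ => energyFraction μ Z r k (p ζ)).HasTemperateGrowth := fun k =>
    (hasTemperateGrowth_energyFraction k).comp p.hasTemperateGrowth
  have hsT : (fun ζ => sourceWeight Z q s j (p ζ) ^ 2).HasTemperateGrowth :=
    ((sourceWeight_hasTemperateGrowth Z q s j).comp p.hasTemperateGrowth).pow 2
  set G := density (fun ζ => chainWeight μ Z r κ j (p ζ)) f
  obtain ⟨hGint, hG⟩ := integral_fderiv_apply_linear A G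
  have hpt : ∀ ζ, (bracket (p ζ) ^ κ * energyFraction μ Z r (j + 1) (p ζ)) * ‖f ζ‖ ^ 2 ≤
      (fderiv ℝ G ζ (A ζ) + τ * G ζ) + (ε * (bracket (p ζ) ^ κ * ‖f ζ‖ ^ 2) +
      C * ((bracket (p ζ) ^ κ * energyFraction μ Z r j (p ζ)) * ‖f ζ‖ ^ 2) +
      C * (sourceWeight Z q s j (p ζ) ^ 2 * ‖h ζ‖ ^ 2)) := by
    intro ζ
    have hline : HasDerivAt (fun t : ℝ => p (ζ + t • A ζ)) (M (p (ζ + (0 : ℝ) • A ζ))) 0 := by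
      have := p.hasFDerivAt.comp_hasDerivAt (0 : ℝ)
        (((hasDerivAt_id (0 : ℝ)).smul_const (A ζ)).const_add ζ)
      simpa [hp, Function.comp_def] using this
    obtain ⟨d, hd, hdle⟩ := hder _ 0 hline
    rw [zero_smul, add_zero] at hdle
    rw [fderiv_density_apply hwT hfh hd, density_apply hwT]
    have hg1 := abs_chainWeight_le_sqrt (Z := Z) (κ := κ) hj (hμ.mono j) (p ζ)
    have hg2 := abs_chainWeight_le_sourceWeight (Z := Z) (κ := κ) hj hq0 hq1 hs (p ζ)
    have hin := abs_real_inner_le_norm (f ζ) (h ζ)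
    have hx0 := energyFraction_nonneg (μ := μ) (Z := Z) (r := r) j (p ζ)
    have hRR : bracket (p ζ) ^ (κ / 2) * bracket (p ζ) ^ (κ / 2) = bracket (p ζ) ^ κ := by
      rw [← Real.rpow_add (bracket_pos _), add_halves]
    have hR0 : 0 < bracket (p ζ) ^ (κ / 2) := Real.rpow_pos_of_pos (bracket_pos _) _
    have hW0 : 0 ≤ sourceWeight Z q s j (p ζ) :=
      mul_nonneg (Real.rpow_pos_of_pos (bracket_pos _) _).le
        (Real.rpow_pos_of_pos (bracket_pos _) _).le
    set g := chainWeight μ Z r κ j (p ζ)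
    set W := sourceWeight Z q s j (p ζ)
    set x₀ := energyFraction μ Z r j (p ζ)
    set x₁ := energyFraction μ Z r (j + 1) (p ζ)
    rw [← hRR] at hdle hg1 ⊢
    set R := bracket (p ζ) ^ (κ / 2)
    -- the three errors, each split by the inequality of arithmetic and geometric means
    have e1 : C₁ * √x₀ ≤ ε / 2 + C₁ ^ 2 / (2 * ε) * x₀ := by
      have hsq := Real.sq_sqrt hx0
      have : ε / 2 + C₁ ^ 2 / (2 * ε) * x₀ - C₁ * √x₀ = (ε - C₁ * √x₀) ^ 2 / (2 * ε) := by
        rw [← hsq, Real.sqrt_sq (Real.sqrt_nonneg _)]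
        field_simp
        ring
      have h0 : 0 ≤ (ε - C₁ * √x₀) ^ 2 / (2 * ε) := by positivity
      linarith
    have e2 : 2 * g * inner ℝ (f ζ) (h ζ) ≤
        ε / 2 * (R * R * ‖f ζ‖ ^ 2) + 2 / ε * (W ^ 2 * ‖h ζ‖ ^ 2) := by
      have h1 : g * inner ℝ (f ζ) (h ζ) ≤ (R * W) * (‖f ζ‖ * ‖h ζ‖) := by
        refine (le_abs_self _).trans ?_
        rw [abs_mul]
        gcongr
      have h2 : ε / 2 * (R * R * ‖f ζ‖ ^ 2) + 2 / ε * (W ^ 2 * ‖h ζ‖ ^ 2) -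
          2 * ((R * W) * (‖f ζ‖ * ‖h ζ‖)) = (ε * (R * ‖f ζ‖) - 2 * (W * ‖h ζ‖)) ^ 2 / (2 * ε) := by
        field_simp
        ring
      have h0 : 0 ≤ (ε * (R * ‖f ζ‖) - 2 * (W * ‖h ζ‖)) ^ 2 / (2 * ε) := by positivity
      linarith
    have e3 : (2 * b - τ) * (g * ‖f ζ‖ ^ 2) ≤ |2 * b - τ| * (R * R * √x₀ * ‖f ζ‖ ^ 2) := by
      refine (le_abs_self _).trans ?_
      rw [abs_mul, abs_mul, abs_of_nonneg (sq_nonneg ‖f ζ‖)]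
      gcongr
    have e4 := mul_le_mul_of_nonneg_right hdle (sq_nonneg ‖f ζ‖)
    have e5 := mul_le_mul_of_nonneg_left e1 (show 0 ≤ R * R * ‖f ζ‖ ^ 2 by positivity)
    have e6 : 0 ≤ 2 / ε * ((R * R * x₀) * ‖f ζ‖ ^ 2) := by positivity
    have e7 : 0 ≤ C₁ ^ 2 / (2 * ε) * (W ^ 2 * ‖h ζ‖ ^ 2) := by positivity
    rw [hC, add_mul, add_mul]
    rw [hC₁] at e5
    nlinarith
  have hN := integrable_mul_norm_sq hbT f
  have hX := fun k => integrable_mul_norm_sq (hbT.mul (hxT k)) f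
  have hH := integrable_mul_norm_sq hsT h
  have hsum := integral_mono (hX (j + 1)) ((hGint.add (G.integrable.const_mul τ)).add
    (((hN.const_mul ε).add ((hX j).const_mul C)).add (hH.const_mul C))) hpt
  refine hsum.trans_eq ?_
  rw [integral_add' (hGint.add (G.integrable.const_mul τ))
      (((hN.const_mul ε).add ((hX j).const_mul C)).add (hH.const_mul C)),
    integral_add' hGint (G.integrable.const_mul τ),
    integral_add' ((hN.const_mul ε).add ((hX j).const_mul C)) (hH.const_mul C),
    integral_add' (hN.const_mul ε) ((hX j).const_mul C), integral_const_mul, integral_const_mul,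
    integral_const_mul, integral_const_mul, hG]
  simp only [Pi.mul_apply]
  ring

end estimates

end

section

open Finset MeasureTheory

section estimates

variable {m : ℕ} {V F : Type*} [NormedAddCommGroup V] [InnerProductSpace ℝ V]
  [NormedAddCommGroup F] [InnerProductSpace ℝ F]
  {μ : ℕ → ℝ} {Z : ℕ → V →L[ℝ] F} {r : ℕ} {q s : ℕ → ℝ}
  {A : EuclideanSpace ℝ (Fin m) →L[ℝ] EuclideanSpace ℝ (Fin m)} {M : V →L[ℝ] V}
  {p : EuclideanSpace ℝ (Fin m) →L[ℝ] V} {b : ℝ}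

/-- The sum of the squares of the norms on the right-hand side of the estimate, on the Fourier
side. -/
def dataEnergy (p : EuclideanSpace ℝ (Fin m) →L[ℝ] V) (Z : ℕ → V →L[ℝ] F) (a : ℝ)
    (q s : ℕ → ℝ) (r : ℕ) (f h : 𝓢(EuclideanSpace ℝ (Fin m), ℂ)) : ℝ :=
  (∫ ζ, (bracket (Z 0 (p ζ)) ^ a) ^ 2 * ‖f ζ‖ ^ 2) +
    ∑ j ∈ range r, ∫ ζ, sourceWeight Z q s j (p ζ) ^ 2 * ‖h ζ‖ ^ 2

theorem integral_sourceWeight_le_dataEnergy {a : ℝ} {j : ℕ} (hj : j < r)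
    (f h : 𝓢(EuclideanSpace ℝ (Fin m), ℂ)) :
    ∫ ζ, sourceWeight Z q s j (p ζ) ^ 2 * ‖h ζ‖ ^ 2 ≤ dataEnergy p Z a q s r f h := by
  have h1 := single_le_sum (f := fun j => ∫ ζ, sourceWeight Z q s j (p ζ) ^ 2 * ‖h ζ‖ ^ 2)
    (fun _ _ => integral_nonneg fun ζ => by positivity) (mem_range.2 hj)
  exact h1.trans (le_add_of_nonneg_left (integral_nonneg fun ζ => by positivity))

theorem integral_bracket_le_dataEnergy {a : ℝ} (f h : 𝓢(EuclideanSpace ℝ (Fin m), ℂ)) :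
    ∫ ζ, (bracket (Z 0 (p ζ)) ^ a) ^ 2 * ‖f ζ‖ ^ 2 ≤ dataEnergy p Z a q s r f h :=
  le_add_of_nonneg_right (sum_nonneg fun _ _ => integral_nonneg fun ζ => by positivity)

/-- The energy of every level is controlled by the data, up to an arbitrarily small multiple of the
quantity to be estimated: iterate the step from level to level, starting from level `0`. -/
theorem exists_integral_energyFraction_le (hμ : IsScale μ r)
    (hZ : ∀ k η, Z k (M η) = Z (k + 1) η) (hp : ∀ ζ, p (A ζ) = M (p ζ)) {a : ℝ} (ha : 0 < a)
    (hq0 : ∀ j < r, 0 ≤ q j) (hq1 : ∀ j < r, q j ≤ 1)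
    (hs : ∀ j < r, a * μ 0 + (1 - q j) * μ j - μ (j + 1) ≤ s j) {j : ℕ} (hj : j ≤ r) :
    ∀ {ε : ℝ}, 0 < ε → ∃ C, 0 ≤ C ∧ ∀ f h : 𝓢(EuclideanSpace ℝ (Fin m), ℂ),
      IsTransportSource A b f h →
      ∫ ζ, (bracket (p ζ) ^ (2 * (a * μ 0)) * energyFraction μ Z r j (p ζ)) * ‖f ζ‖ ^ 2 ≤
        ε * (∫ ζ, bracket (p ζ) ^ (2 * (a * μ 0)) * ‖f ζ‖ ^ 2) +
        C * dataEnergy p Z a q s r f h := by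
  have hκ : 0 ≤ 2 * (a * μ 0) := by have := hμ.nonneg 0; positivity
  induction j with
  | zero =>
    intro ε hε
    refine ⟨ε ^ (-a), by positivity, fun f h _ => ?_⟩
    have hbT := bracket_comp_rpow_hasTemperateGrowth p (2 * (a * μ 0))
    have hxT : (fun ζ => energyFraction μ Z r 0 (p ζ)).HasTemperateGrowth :=
      (hasTemperateGrowth_energyFraction 0).comp p.hasTemperateGrowth
    have hN := integrable_mul_norm_sq hbT f
    have hX := integrable_mul_norm_sq (hbT.mul hxT) f
    have hW := integrable_mul_norm_sq
      ((bracket_comp_rpow_hasTemperateGrowth ((Z 0) ∘L p) a).pow 2) f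
    have hle := integral_mono hX ((hN.const_mul ε).add (hW.const_mul (ε ^ (-a)))) fun ζ => by
      have h0 := mul_le_mul_of_nonneg_right
        (bracket_rpow_mul_energyFraction_zero_le (μ := μ) (Z := Z) (r := r) ha hε (p ζ))
        (sq_nonneg ‖f ζ‖)
      refine h0.trans_eq ?_
      simp only [Pi.add_apply, Pi.pow_apply, ContinuousLinearMap.comp_apply]
      ring
    refine hle.trans ?_
    rw [integral_add' (hN.const_mul ε) (hW.const_mul _), integral_const_mul, integral_const_mul]
    gcongr
    exact integral_bracket_le_dataEnergy f h
  | succ j ih =>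
    intro ε hε
    obtain ⟨C₁, hC₁, h1⟩ := exists_integral_energyFraction_succ_le (A := A) (b := b) (q := q)
      (s := s) hμ hZ hp hκ hj (hq0 j hj) (hq1 j hj)
      (by rw [mul_div_cancel_left₀ _ two_ne_zero]; exact hs j hj) (half_pos hε)
    obtain ⟨C₂, hC₂, h2⟩ := ih (by omega) (ε := ε / 2 / (C₁ + 1)) (by positivity)
    refine ⟨C₁ * C₂ + C₁, by positivity, fun f h hfh => (h1 f h hfh).trans ?_⟩
    have hN : 0 ≤ ∫ ζ, bracket (p ζ) ^ (2 * (a * μ 0)) * ‖f ζ‖ ^ 2 :=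
      integral_nonneg fun ζ =>
        mul_nonneg (Real.rpow_pos_of_pos (bracket_pos _) _).le (sq_nonneg _)
    have h3 := mul_le_mul_of_nonneg_left (h2 f h hfh) hC₁
    have h4 := mul_le_mul_of_nonneg_left
      (integral_sourceWeight_le_dataEnergy (p := p) (Z := Z) (q := q) (s := s) (a := a) hj f h) hC₁
    have h5 : C₁ * (ε / 2 / (C₁ + 1)) ≤ ε / 2 := by
      rw [mul_div_assoc', div_le_iff₀ (by positivity)]
      nlinarith
    have h6 := mul_le_mul_of_nonneg_right h5 hN
    linarith

/-- The hypoelliptic estimate on the Fourier side. -/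
theorem exists_integral_bracket_rpow_le (hμ : IsScale μ r)
    (hZ : ∀ k η, Z k (M η) = Z (k + 1) η) (hp : ∀ ζ, p (A ζ) = M (p ζ)) {a : ℝ} (ha : 0 < a)
    {c : ℝ} (hc : 0 < c) (hcoer : ∀ η, c * ‖η‖ ^ 2 ≤ ∑ k ∈ Icc 0 r, ‖Z k η‖ ^ 2)
    (hq0 : ∀ j < r, 0 ≤ q j) (hq1 : ∀ j < r, q j ≤ 1)
    (hs : ∀ j < r, a * μ 0 + (1 - q j) * μ j - μ (j + 1) ≤ s j) :
    ∃ C, 0 ≤ C ∧ ∀ f h : 𝓢(EuclideanSpace ℝ (Fin m), ℂ), IsTransportSource A b f h →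
      ∫ ζ, bracket (p ζ) ^ (2 * (a * μ 0)) * ‖f ζ‖ ^ 2 ≤ C * dataEnergy p Z a q s r f h := by
  have hκ : 0 ≤ 2 * (a * μ 0) := by have := hμ.nonneg 0; positivity
  obtain ⟨K, hK, hsum⟩ := exists_bracket_rpow_le_sum_energyFraction hμ hc hcoer hκ
  -- with this `ε`, the `r + 1` levels together cost half of the left-hand side
  have hε : 0 < 1 / (2 * K * (r + 1)) := by positivity
  have hX : ∀ j : ℕ, ∃ C, 0 ≤ C ∧ (j ≤ r → ∀ f h : 𝓢(EuclideanSpace ℝ (Fin m), ℂ),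
      IsTransportSource A b f h →
      ∫ ζ, (bracket (p ζ) ^ (2 * (a * μ 0)) * energyFraction μ Z r j (p ζ)) * ‖f ζ‖ ^ 2 ≤
        1 / (2 * K * (r + 1)) * (∫ ζ, bracket (p ζ) ^ (2 * (a * μ 0)) * ‖f ζ‖ ^ 2) +
        C * dataEnergy p Z a q s r f h) := by
    intro j
    by_cases hj : j ≤ r
    · obtain ⟨C, hC, h⟩ := exists_integral_energyFraction_le (A := A) (b := b) hμ hZ hp ha hq0 hq1
        hs hj hε
      exact ⟨C, hC, fun _ => h⟩
    · exact ⟨0, le_rfl, fun h => absurd h hj⟩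
  choose C hC0 hC using hX
  have hCs : 0 ≤ ∑ j ∈ Icc 0 r, C j := sum_nonneg fun j _ => hC0 j
  refine ⟨2 * (K * ∑ j ∈ Icc 0 r, C j + K), by positivity, fun f h hfh => ?_⟩
  have hbT := bracket_comp_rpow_hasTemperateGrowth p (2 * (a * μ 0))
  have hxT : ∀ k, (fun ζ => energyFraction μ Z r k (p ζ)).HasTemperateGrowth := fun k =>
    (hasTemperateGrowth_energyFraction k).comp p.hasTemperateGrowth
  have hN := integrable_mul_norm_sq hbT f
  have hXint : ∀ k, Integrable fun ζ =>
      (bracket (p ζ) ^ (2 * (a * μ 0)) * energyFraction μ Z r k (p ζ)) * ‖f ζ‖ ^ 2 :=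
    fun k => integrable_mul_norm_sq (hbT.mul (hxT k)) f
  have hW : Integrable fun ζ => (bracket (Z 0 (p ζ)) ^ a) ^ 2 * ‖f ζ‖ ^ 2 :=
    integrable_mul_norm_sq ((bracket_comp_rpow_hasTemperateGrowth ((Z 0) ∘L p) a).pow 2) f
  have hle := integral_mono hN
    (((integrable_finsetSum (Icc 0 r) fun k _ => hXint k).const_mul K).add (hW.const_mul K))
    fun ζ => by
      have h1 := mul_le_mul_of_nonneg_right (hsum (p ζ)) (sq_nonneg ‖f ζ‖)
      have h2 : 1 ≤ (bracket (Z 0 (p ζ)) ^ a) ^ 2 :=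
        one_le_pow₀ (Real.one_le_rpow (one_le_bracket _) ha.le)
      have h3 := mul_le_mul_of_nonneg_left h2 (mul_nonneg hK.le (sq_nonneg ‖f ζ‖))
      refine h1.trans ?_
      simp only [Pi.add_apply]
      rw [add_mul, mul_assoc K, sum_mul]
      linarith
  rw [integral_add' ((integrable_finsetSum (Icc 0 r) fun k _ => hXint k).const_mul K)
    (hW.const_mul K), integral_const_mul, integral_const_mul,
    integral_finsetSum _ fun k _ => hXint k] at hle
  have hCf := fun k hk => hC k hk f h hfh
  set N := ∫ ζ, bracket (p ζ) ^ (2 * (a * μ 0)) * ‖f ζ‖ ^ 2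
  clear_value N
  set T := dataEnergy p Z a q s r f h
  have h4 : ∑ k ∈ Icc 0 r, ∫ ζ, (bracket (p ζ) ^ (2 * (a * μ 0)) *
      energyFraction μ Z r k (p ζ)) * ‖f ζ‖ ^ 2 ≤ N / (2 * K) + (∑ j ∈ Icc 0 r, C j) * T := by
    refine (sum_le_sum fun k hk => hCf k (mem_Icc.1 hk).2).trans_eq ?_
    rw [sum_add_distrib, sum_const, ← sum_mul, Nat.card_Icc, nsmul_eq_mul]
    push_cast
    field_simp
  have h5 := mul_le_mul_of_nonneg_left h4 hK.le
  have h6 := mul_le_mul_of_nonneg_left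
    (integral_bracket_le_dataEnergy (p := p) (Z := Z) (q := q) (s := s) (r := r) (a := a) f h) hK.le
  have h7 : K * (N / (2 * K)) = N / 2 := by field_simp
  rw [mul_add, h7] at h5
  linarith

end estimates

/-! ### The transport operator on the Fourier side -/

section fourier

open FourierTransform

variable {m n : ℕ}

/-- The Fourier transform of `x_j ∂_i u` is `-∂_j (ζ_i 𝓕 u)`; the factors `2π` cancel. -/
theorem fourier_coord_mul_lineDeriv (u : 𝓢(EuclideanSpace ℝ (Fin m), ℂ)) (i j : Fin m)
    (ζ : EuclideanSpace ℝ (Fin m)) :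
    𝓕 (SchwartzMap.smulLeftCLM ℂ (fun x : EuclideanSpace ℝ (Fin m) => x j)
      (LineDeriv.lineDerivOp (EuclideanSpace.single i (1 : ℝ)) u)) ζ =
      -((if i = j then 1 else 0) * 𝓕 u ζ +
        ζ i * fderiv ℝ (𝓕 u : 𝓢(EuclideanSpace ℝ (Fin m), ℂ)) ζ (EuclideanSpace.single j 1)) := by
  have hc : (2 * Real.pi * Complex.I : ℂ) ≠ 0 := Complex.two_pi_I_ne_zero
  have hin : ∀ k : Fin m, (fun x : EuclideanSpace ℝ (Fin m) =>
      inner ℝ x (EuclideanSpace.single k (1 : ℝ))) = fun x => x k := by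
    intro k
    funext x
    simp [EuclideanSpace.inner_single_right]
  have h1 := congrArg (fun g => g ζ) (SchwartzMap.lineDerivOp_fourier_eq
    (LineDeriv.lineDerivOp (EuclideanSpace.single i (1 : ℝ)) u) (EuclideanSpace.single j (1 : ℝ)))
  simp only [hin, SchwartzMap.fourier_lineDerivOp_eq, SchwartzMap.lineDerivOp_apply_eq_fderiv,
    FourierTransform.fourier_smul, smul_apply] at h1
  have h2 : (⇑((2 * Real.pi * Complex.I : ℂ) • SchwartzMap.smulLeftCLM ℂ
      (fun x : EuclideanSpace ℝ (Fin m) => x i) (𝓕 u))) =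
      fun x => (2 * Real.pi * Complex.I : ℂ) • (x i • 𝓕 u x) := by
    funext x
    rw [smul_apply, SchwartzMap.smulLeftCLM_apply_apply (coord_hasTemperateGrowth i)]
  have h3 : HasFDerivAt (fun x : EuclideanSpace ℝ (Fin m) => x i • 𝓕 u x) _ ζ :=
    (EuclideanSpace.proj i : EuclideanSpace ℝ (Fin m) →L[ℝ] ℝ).hasFDerivAt.smul
      ((𝓕 u).hasFDerivAt ζ)
  have h3' : HasFDerivAt (fun x : EuclideanSpace ℝ (Fin m) =>
      (2 * Real.pi * Complex.I : ℂ) • (x i • 𝓕 u x)) _ ζ := h3.fun_const_smul _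
  rw [h2, h3'.fderiv] at h1
  apply mul_left_cancel₀ hc
  have h4 := h1.symm
  simp only [smul_eq_mul, neg_mul, neg_eq_iff_eq_neg] at h4
  rw [h4]
  simp
  split_ifs <;> ring

theorem fourier_transport_apply (B : Matrix (Fin m) (Fin m) ℝ)
    (u : 𝓢(EuclideanSpace ℝ (Fin m), ℂ)) (ζ : EuclideanSpace ℝ (Fin m)) :
    𝓕 (transport B u) ζ =
      -fderiv ℝ (𝓕 u : 𝓢(EuclideanSpace ℝ (Fin m), ℂ)) ζ (Matrix.toEuclideanCLM (𝕜 := ℝ) Bᵀ ζ) - (B.trace : ℝ) * 𝓕 u ζ := by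
  have hA : Matrix.toEuclideanCLM (𝕜 := ℝ) Bᵀ ζ =
      ∑ j, (∑ i, B i j * ζ i) • EuclideanSpace.single j (1 : ℝ) := by
    ext k
    simp [Matrix.mulVec, dotProduct, Finset.sum_apply, Pi.single_apply]
  have hF : 𝓕 (transport B u) ζ = ∑ i, ∑ j, (B i j : ℂ) * (-((if i = j then 1 else 0) * 𝓕 u ζ +
        ζ i * fderiv ℝ (𝓕 u : 𝓢(EuclideanSpace ℝ (Fin m), ℂ)) ζ (EuclideanSpace.single j 1))) := by
    have : 𝓕 (transport B u) = ∑ i, ∑ j, B i j • 𝓕 (SchwartzMap.smulLeftCLM ℂ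
        (fun x : EuclideanSpace ℝ (Fin m) => x j)
        (LineDeriv.lineDerivOp (EuclideanSpace.single i (1 : ℝ)) u)) := by
      simp only [transport, ← FourierTransform.fourierCLM_apply (R := ℝ), map_sum, map_smul]
    rw [this]
    simp only [_root_.sum_apply, smul_apply, fourier_coord_mul_lineDeriv,
      Complex.real_smul]
  rw [hF, hA, map_sum]
  simp only [map_smul, Complex.real_smul, Matrix.trace, Matrix.diag, Complex.ofReal_sum,
    Complex.ofReal_mul, mul_neg, mul_add, sum_neg_distrib, sum_add_distrib, sum_mul]
  rw [sum_comm (f := fun i j => (B i j : ℂ) * (ζ i * _))]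
  simp [mul_assoc]
  ring

theorem isTransportSource_transport (B : Matrix (Fin m) (Fin m) ℝ)
    (u : 𝓢(EuclideanSpace ℝ (Fin m), ℂ)) :
    IsTransportSource (Matrix.toEuclideanCLM (𝕜 := ℝ) Bᵀ) B.trace (𝓕 u) (𝓕 (transport B u)) :=
  ⟨fun _ => 0, fun ζ => by rw [fourier_transport_apply]; simp⟩

/-- The matrix of the linear vector field `(t, x) ↦ (0, B x)`. -/
def extendZero (B : Matrix (Fin n) (Fin n) ℝ) : Matrix (Fin (n + 1)) (Fin (n + 1)) ℝ :=
  Matrix.of (Fin.cons 0 fun i => Fin.cons 0 (B i))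

theorem timeTransport_eq (B : Matrix (Fin n) (Fin n) ℝ)
    (u : 𝓢(EuclideanSpace ℝ (Fin (n + 1)), ℂ)) :
    timeTransport B u = LineDeriv.lineDerivOp (EuclideanSpace.single (0 : Fin (n + 1)) (1 : ℝ)) u +
      transport (extendZero B) u := by
  simp [timeTransport, transport, extendZero, Fin.sum_univ_succ]

theorem isTransportSource_timeTransport (B : Matrix (Fin n) (Fin n) ℝ)
    (u : 𝓢(EuclideanSpace ℝ (Fin (n + 1)), ℂ)) :
    IsTransportSource (Matrix.toEuclideanCLM (𝕜 := ℝ) (extendZero B)ᵀ) (extendZero B).trace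
      (𝓕 u) (𝓕 (timeTransport B u)) := by
  refine ⟨fun ζ => 2 * Real.pi * ζ 0, fun ζ => ?_⟩
  have hT : (fun x : EuclideanSpace ℝ (Fin (n + 1)) =>
      inner ℝ x (EuclideanSpace.single 0 (1 : ℝ))).HasTemperateGrowth := by fun_prop
  rw [timeTransport_eq, FourierTransform.fourier_add, add_apply,
    fourier_transport_apply, SchwartzMap.fourier_lineDerivOp_eq, smul_apply,
    SchwartzMap.smulLeftCLM_apply_apply hT]
  simp [EuclideanSpace.inner_single_right]
  ring

theorem spacePart_apply (ζ : EuclideanSpace ℝ (Fin (n + 1))) (i : Fin n) :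
    spacePart n ζ i = ζ i.succ := rfl

theorem spacePart_extendZero (B : Matrix (Fin n) (Fin n) ℝ)
    (ζ : EuclideanSpace ℝ (Fin (n + 1))) :
    spacePart n (Matrix.toEuclideanCLM (𝕜 := ℝ) (extendZero B)ᵀ ζ) =
      Matrix.toEuclideanCLM (𝕜 := ℝ) Bᵀ (spacePart n ζ) := by
  ext i
  simp [spacePart_apply, extendZero, Matrix.mulVec, dotProduct, Fin.sum_univ_succ]

/-- Plancherel. -/
theorem sq_normL2 (u : 𝓢(EuclideanSpace ℝ (Fin m), ℂ)) :
    normL2 u ^ 2 = ∫ ζ, ‖𝓕 u ζ‖ ^ 2 := by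
  rw [SchwartzMap.integral_norm_sq_fourier, normL2, ← inner_self_eq_norm_sq (𝕜 := ℂ)]
  have h := SchwartzMap.inner_toL2_toL2_eq u u
  rw [h]
  simp only [inner_self_eq_norm_sq_to_K]
  norm_cast

theorem sq_normL2_multiplierDx (p : EuclideanSpace ℝ (Fin m) →L[ℝ] EuclideanSpace ℝ (Fin n))
    {G : EuclideanSpace ℝ (Fin n) → ℝ} (hG : G.HasTemperateGrowth)
    (u : 𝓢(EuclideanSpace ℝ (Fin m), ℂ)) :
    normL2 (multiplierDx p G u) ^ 2 = ∫ ζ, G ((2 * Real.pi) • p ζ) ^ 2 * ‖𝓕 u ζ‖ ^ 2 := by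
  rw [sq_normL2]
  refine integral_congr_ae (.of_forall fun ζ => ?_)
  simp only [fourier_multiplierDx_apply p hG, norm_mul, mul_pow, Complex.norm_real,
    Real.norm_eq_abs, sq_abs]

theorem sq_normHs_multiplierDx (p : EuclideanSpace ℝ (Fin m) →L[ℝ] EuclideanSpace ℝ (Fin n))
    {G : EuclideanSpace ℝ (Fin n) → ℝ} (hG : G.HasTemperateGrowth) (σ : ℝ)
    (u : 𝓢(EuclideanSpace ℝ (Fin m), ℂ)) :
    normHs p σ (multiplierDx p G u) ^ 2 =
      ∫ ζ, (bracket ((2 * Real.pi) • p ζ) ^ σ * G ((2 * Real.pi) • p ζ)) ^ 2 * ‖𝓕 u ζ‖ ^ 2 := by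
  rw [normHs, sq_normL2_multiplierDx p (bracket_rpow_hasTemperateGrowth σ)]
  refine integral_congr_ae (.of_forall fun ζ => ?_)
  simp only [fourier_multiplierDx_apply p hG, norm_mul, mul_pow, Complex.norm_real,
    Real.norm_eq_abs, sq_abs, mul_assoc]

end fourier

end

section

open Finset FourierTransform

/-! ### Kalman chains and the recursion of the exponents -/

section main

variable {m n : ℕ}

/-- The chain `Q (Bᵀ) ^ k` of the Kalman condition, as operators. -/
def kalmanChain (B Q : Matrix (Fin n) (Fin n) ℝ) (k : ℕ) :
    EuclideanSpace ℝ (Fin n) →L[ℝ] EuclideanSpace ℝ (Fin n) :=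
  Matrix.toEuclideanCLM (𝕜 := ℝ) (Q * Bᵀ ^ k)

theorem kalmanChain_apply_transpose (B Q : Matrix (Fin n) (Fin n) ℝ) (k : ℕ)
    (η : EuclideanSpace ℝ (Fin n)) :
    kalmanChain B Q k (Matrix.toEuclideanCLM (𝕜 := ℝ) Bᵀ η) = kalmanChain B Q (k + 1) η := by
  rw [kalmanChain, kalmanChain, pow_succ, ← mul_assoc, map_mul _ (Q * Bᵀ ^ k)]
  rfl

theorem bracketSymbol_eq (B Q : Matrix (Fin n) (Fin n) ℝ) (k : ℕ) (σ : ℝ)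
    (η : EuclideanSpace ℝ (Fin n)) :
    bracketSymbol (Q * Bᵀ ^ k) σ η = bracket (kalmanChain B Q k η) ^ σ := rfl

/-- The Kalman index makes the chain up to level `r` an injective linear map on a
finite-dimensional space. -/
theorem exists_kalmanChain_coercive {B Q : Matrix (Fin n) (Fin n) ℝ} {r : ℕ}
    (hr : IsKalmanIndex B Q r) :
    ∃ c, 0 < c ∧ ∀ η, c * ‖η‖ ^ 2 ≤ ∑ k ∈ Icc 0 r, ‖kalmanChain B Q k η‖ ^ 2 := by
  let Φ : EuclideanSpace ℝ (Fin n) →L[ℝ] (Icc 0 r → EuclideanSpace ℝ (Fin n)) :=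
    ContinuousLinearMap.pi fun k => kalmanChain B Q k
  have hker : LinearMap.ker Φ.toLinearMap = ⊥ := by
    rw [LinearMap.ker_eq_bot']
    intro η hη
    have h0 : η.ofLp = 0 := by
      refine hr.1.2 _ fun j hj => ?_
      have := congrFun hη ⟨j, mem_Icc.2 ⟨Nat.zero_le j, hj⟩⟩
      exact congrArg WithLp.ofLp this
    ext i
    exact congrFun h0 i
  obtain ⟨K, hK, hanti⟩ := Φ.toLinearMap.exists_antilipschitzWith hker
  have hK' : (0 : ℝ) < K := hK
  refine ⟨((K : ℝ) ^ 2)⁻¹, by positivity, fun η => ?_⟩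
  have h1 : ‖η‖ ≤ K * ‖Φ η‖ := by
    simpa using hanti.le_mul_dist η 0
  have h2 : ‖Φ η‖ ≤ √(∑ k ∈ Icc 0 r, ‖kalmanChain B Q k η‖ ^ 2) := by
    refine (pi_norm_le_iff_of_nonneg (Real.sqrt_nonneg _)).2 fun k => Real.le_sqrt_of_sq_le ?_
    exact single_le_sum (f := fun k => ‖kalmanChain B Q k η‖ ^ 2)
      (fun _ _ => by positivity) k.2
  have h3 := Real.sq_sqrt (sum_nonneg fun k (_ : k ∈ Icc 0 r) =>
    sq_nonneg ‖kalmanChain B Q k η‖)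
  rw [inv_mul_le_iff₀ (by positivity), ← h3, ← mul_pow]
  gcongr
  exact h1.trans (by gcongr)

/-- The exponent `λ_r / λ_k` of level `k`, extended by `1` beyond `r`: the threshold at which
`⟨Z k η⟩ ^ λ_k` reaches `⟨η⟩ ^ λ_r`. -/
def scaleExponent (lam : ℕ → ℝ) (r k : ℕ) : ℝ := if k ≤ r then lam r / lam k else 1

theorem isScale_scaleExponent {lam : ℕ → ℝ} {r : ℕ} (hpos : ∀ j ≤ r, 0 < lam j)
    (hdecr : ∀ j < r, lam (j + 1) < lam j)
    (hratio : ∀ j, 2 ≤ j → j ≤ r → lam (j - 1) / lam (j - 2) + lam (j - 1) / lam j ≤ 2) :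
    IsScale (scaleExponent lam r) r := by
  have htop : ∀ k, r ≤ k → scaleExponent lam r k = 1 := by
    intro k hk
    unfold scaleExponent
    split_ifs with h
    · obtain rfl : k = r := le_antisymm h hk
      exact div_self (hpos k le_rfl).ne'
    · rfl
  have hlow : ∀ k ≤ r, scaleExponent lam r k = lam r / lam k := fun k hk => if_pos hk
  have hmono : ∀ k, scaleExponent lam r k ≤ scaleExponent lam r (k + 1) := by
    intro k
    rcases Nat.lt_or_ge k r with h | h
    · rw [hlow k h.le, hlow (k + 1) h]
      exact div_le_div_of_nonneg_left (hpos r le_rfl).le (hpos _ h) (hdecr k h).le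
    · rw [htop k h, htop (k + 1) (by omega)]
  refine ⟨fun k => ?_, fun k => ?_, hmono, fun k => ?_, htop⟩
  · unfold scaleExponent
    split_ifs with h
    · exact div_nonneg (hpos r le_rfl).le (hpos k h).le
    · exact zero_le_one
  · have := monotone_nat_of_le_succ hmono (Nat.le_add_right k r)
    rwa [htop (k + r) (by omega)] at this
  · rcases Nat.lt_or_ge r (k + 2) with h | h
    · rw [htop (k + 2) h.le, htop (k + 1) (by omega), sub_self]
      have := hmono k
      rw [htop (k + 1) (by omega)] at this
      linarith
    · rw [hlow _ h, hlow (k + 1) (by omega), hlow k (by omega)]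
      have h1 := hratio (k + 2) (by omega) h
      rw [show k + 2 - 1 = k + 1 by omega, show k + 2 - 2 = k by omega] at h1
      have hr := hpos r le_rfl
      have hk1 := hpos (k + 1) (by omega)
      have e : ∀ x, lam r / x = lam r / lam (k + 1) * (lam (k + 1) / x) := by
        intro x
        field_simp
      have h2 := mul_le_mul_of_nonneg_left h1 (div_pos hr hk1).le
      rw [mul_add, ← e, ← e] at h2
      linarith

/-- The estimate for any operator which is a transport operator on the Fourier side, in terms of a
projection `p` onto the frequencies dual to `x` that intertwines its vector field with `Bᵀ`. -/
theorem exists_normHs_le {B Q : Matrix (Fin n) (Fin n) ℝ} {r : ℕ} (hr : IsKalmanIndex B Q r)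
    {q s lam : ℕ → ℝ} (hq0 : ∀ j < r, 0 ≤ q j) (hq1 : ∀ j < r, q j ≤ 1) (hs0 : ∀ j < r, 0 ≤ s j)
    (hlam0 : 0 < lam 0) (hlam : ∀ j < r, lam (j + 1) * ((1 - q j) / lam j + 1) = 1 + s j)
    (hdecr : ∀ j < r, lam (j + 1) < lam j)
    (hratio : ∀ j, 2 ≤ j → j ≤ r → lam (j - 1) / lam (j - 2) + lam (j - 1) / lam j ≤ 2)
    (p : EuclideanSpace ℝ (Fin m) →L[ℝ] EuclideanSpace ℝ (Fin n))
    (A : EuclideanSpace ℝ (Fin m) →L[ℝ] EuclideanSpace ℝ (Fin m)) (b : ℝ)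
    (hp : ∀ ζ, p (A ζ) = Matrix.toEuclideanCLM (𝕜 := ℝ) Bᵀ (p ζ))
    (L : 𝓢(EuclideanSpace ℝ (Fin m), ℂ) → 𝓢(EuclideanSpace ℝ (Fin m), ℂ))
    (hL : ∀ u, IsTransportSource A b (𝓕 u) (𝓕 (L u))) :
    ∃ c : ℝ, 0 < c ∧ ∀ u : 𝓢(EuclideanSpace ℝ (Fin m), ℂ),
      normHs p (lam r) u ≤
        c * (normL2 (multiplierDx p (bracketSymbol Q (lam 0)) u) +
          ∑ j ∈ range r, normHs p (s j)
            (multiplierDx p (bracketSymbol (Q * Bᵀ ^ j) (q j)) (L u))) := by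
  have hpos : ∀ j ≤ r, 0 < lam j := by
    intro j
    induction j with
    | zero => exact fun _ => hlam0
    | succ j ih =>
      intro hj
      have h1 := ih (by omega)
      have h2 : 0 < (1 - q j) / lam j + 1 := by
        have := div_nonneg (sub_nonneg.2 (hq1 j hj)) h1.le
        linarith
      refine pos_of_mul_pos_left ?_ h2.le
      rw [hlam j hj]
      linarith [hs0 j hj]
  have hμ := isScale_scaleExponent hpos hdecr hratio
  set μ := scaleExponent lam r with hμdef
  have hlow : ∀ k ≤ r, μ k = lam r / lam k := fun k hk => if_pos hk
  have haμ : lam 0 * μ 0 = lam r := by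
    rw [hlow 0 (Nat.zero_le r), mul_div_cancel₀ _ hlam0.ne']
  -- the recursion gives the value `λ_r s_j / λ_{j+1}`, and `λ_r ≤ λ_{j+1}`
  have hs : ∀ j < r, lam 0 * μ 0 + (1 - q j) * μ j - μ (j + 1) ≤ s j := by
    intro j hj
    have hj1 := hpos (j + 1) hj
    have h1 := hlam j hj
    have h2 : lam r + (1 - q j) * (lam r / lam j) - lam r / lam (j + 1) =
        lam r / lam (j + 1) * s j := by
      have : s j = lam (j + 1) * ((1 - q j) / lam j + 1) - 1 := by linarith
      rw [this]
      field_simp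
      ring
    have h3 : lam r / lam (j + 1) ≤ 1 := by
      rw [← hlow (j + 1) hj]
      exact hμ.le_one _
    rw [haμ, hlow j hj.le, hlow (j + 1) hj, h2]
    exact mul_le_of_le_one_left (hs0 j hj) h3
  obtain ⟨c, hc, hcoer⟩ := exists_kalmanChain_coercive hr
  obtain ⟨C, hC, hest⟩ := exists_integral_bracket_rpow_le (A := A) (b := b)
    (p := (2 * Real.pi) • p) (q := q) (s := s) hμ (kalmanChain_apply_transpose B Q)
    (fun ζ => by rw [smul_apply, smul_apply, map_smul, hp]) hlam0 hc hcoer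
    hq0 hq1 hs
  refine ⟨√C + 1, by positivity, fun u => ?_⟩
  set T₀ := normL2 (multiplierDx p (bracketSymbol Q (lam 0)) u) with hT₀
  set T := fun j => normHs p (s j) (multiplierDx p (bracketSymbol (Q * Bᵀ ^ j) (q j)) (L u)) with hT
  have hT₀0 : 0 ≤ T₀ := norm_nonneg _
  have hT0 : ∀ j, 0 ≤ T j := fun j => norm_nonneg _
  have hN : normHs p (lam r) u ^ 2 = ∫ ζ, bracket (((2 * Real.pi) • p) ζ) ^
      (2 * (lam 0 * μ 0)) * ‖(𝓕 u) ζ‖ ^ 2 := by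
    rw [normHs, sq_normL2_multiplierDx p (bracket_rpow_hasTemperateGrowth _), haμ]
    simp only [← Real.rpow_mul_natCast (bracket_pos _).le, smul_apply]
    simp only [mul_comm (lam r), Nat.cast_ofNat]
  have hdata : dataEnergy ((2 * Real.pi) • p) (kalmanChain B Q) (lam 0) q s r (𝓕 u) (𝓕 (L u)) =
      T₀ ^ 2 + ∑ j ∈ range r, T j ^ 2 := by
    rw [dataEnergy, hT₀, sq_normL2_multiplierDx p (bracketSymbol_hasTemperateGrowth Q _)]
    congr 1
    · simp only [← bracketSymbol_eq, pow_zero, mul_one, smul_apply]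
    · refine sum_congr rfl fun j _ => ?_
      rw [hT, sq_normHs_multiplierDx p (bracketSymbol_hasTemperateGrowth _ _)]
      rfl
  have hsq : T₀ ^ 2 + ∑ j ∈ range r, T j ^ 2 ≤ (T₀ + ∑ j ∈ range r, T j) ^ 2 := by
    have h1 := sum_sq_le_sq_sum_of_nonneg (s := range r) (f := T) fun j _ => hT0 j
    have h2 : 0 ≤ ∑ j ∈ range r, T j := sum_nonneg fun j _ => hT0 j
    nlinarith
  have hfin : normHs p (lam r) u ^ 2 ≤ (√C * (T₀ + ∑ j ∈ range r, T j)) ^ 2 := by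
    rw [hN, mul_pow, Real.sq_sqrt hC]
    have h1 := hest _ _ (hL u)
    rw [hdata] at h1
    exact h1.trans (mul_le_mul_of_nonneg_left hsq hC)
  have hsum : 0 ≤ T₀ + ∑ j ∈ range r, T j := add_nonneg hT₀0 (sum_nonneg fun j _ => hT0 j)
  calc normHs p (lam r) u ≤ √C * (T₀ + ∑ j ∈ range r, T j) :=
        (sq_le_sq₀ (norm_nonneg _) (mul_nonneg (Real.sqrt_nonneg _) hsum)).1 hfin
    _ ≤ (√C + 1) * (T₀ + ∑ j ∈ range r, T j) :=
        mul_le_mul_of_nonneg_right (by linarith) hsum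

end main

end

end Hypoelliptic

end

theorem mainTheorem1 (n : ℕ) (B Q : Matrix (Fin n) (Fin n) ℝ) (hQ : Q.PosSemidef)
    (hK : KalmanRankCondition B Q) (r : ℕ) (hr : IsKalmanIndex B Q r) (hr1 : 1 ≤ r)
    (q s lam : ℕ → ℝ)
    (hq1 : 0 ≤ q (r - 1) ∧ q (r - 1) ≤ 1) (hs1 : 0 ≤ s (r - 1))
    (hq2 : 2 ≤ r → 0 ≤ q (r - 2) ∧ q (r - 2) ≤ q (r - 1))
    (hs2 : 2 ≤ r → 0 ≤ s (r - 2) ∧ s (r - 2) ≤ s (r - 1))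
    (hqs : ∀ j, j + 3 ≤ r → q j = 0 ∧ s j = 0)
    (hlam0 : 0 < lam 0)
    (hlam : ∀ j < r, lam (j + 1) * ((1 - q j) / lam j + 1) = 1 + s j)
    (hdecr : ∀ j < r, lam (j + 1) < lam j)
    (hratio : ∀ j, 2 ≤ j → j ≤ r → lam (j - 1) / lam (j - 2) + lam (j - 1) / lam j ≤ 2) :
    (∃ c : ℝ, 0 < c ∧ ∀ u : SchwartzMap (EuclideanSpace ℝ (Fin (n + 1))) ℂ,
      normHs (spacePart n) (lam r) u ≤
        c * (normL2 (multiplierDx (spacePart n) (bracketSymbol Q (lam 0)) u) +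
          ∑ j ∈ Finset.range r, normHs (spacePart n) (s j)
            (multiplierDx (spacePart n) (bracketSymbol (Q * B.transpose ^ j) (q j))
              (timeTransport B u)))) ∧
    (∃ c : ℝ, 0 < c ∧ ∀ u : SchwartzMap (EuclideanSpace ℝ (Fin n)) ℂ,
      normHs (.id ℝ _) (lam r) u ≤
        c * (normL2 (multiplierDx (.id ℝ _) (bracketSymbol Q (lam 0)) u) +
          ∑ j ∈ Finset.range r, normHs (.id ℝ _) (s j)
            (multiplierDx (.id ℝ _) (bracketSymbol (Q * B.transpose ^ j) (q j))
              (transport B u)))) := by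
  have hbounds : ∀ j < r, (0 ≤ q j ∧ q j ≤ 1) ∧ 0 ≤ s j := by
    intro j hj
    rcases Nat.lt_or_ge r (j + 3) with h | h
    · rcases Nat.lt_or_ge r (j + 2) with h' | h'
      · obtain rfl : j = r - 1 := by omega
        exact ⟨hq1, hs1⟩
      · obtain rfl : j = r - 2 := by omega
        have h2 : 2 ≤ r := by omega
        exact ⟨⟨(hq2 h2).1, (hq2 h2).2.trans hq1.2⟩, (hs2 h2).1⟩
    · rw [(hqs j h).1, (hqs j h).2]
      norm_num
  exact ⟨exists_normHs_le hr (fun j hj => (hbounds j hj).1.1) (fun j hj => (hbounds j hj).1.2)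
      (fun j hj => (hbounds j hj).2) hlam0 hlam hdecr hratio (spacePart n) _ _
      (spacePart_extendZero B) (timeTransport B) (isTransportSource_timeTransport B),
    exists_normHs_le hr (fun j hj => (hbounds j hj).1.1) (fun j hj => (hbounds j hj).1.2)
      (fun j hj => (hbounds j hj).2) hlam0 hlam hdecr hratio (.id ℝ _) _ _
      (fun _ => rfl) (transport B) (isTransportSource_transport B)⟩
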